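/- A triangulation $\mathcal T=(V,E,F)$ of the open disk is a locally finite abstract simplicial complex with vertex set $V$, edge set $E$ and set $F$ of (two-dimensional) faces whose geometric realization is homeomorphic to the open unit disk (equivalently, a triangulation of a simply connected surface with exactly one end); we call it an infinite disk triangulation ($V$ is infinite). Let $\Phi:E\to[0,\frac{\pi}{2}]$. A circle-packing metric is a function $r:V\to(0,\infty)$. It assigns to each edge $\{i,j\}$ the length $$l_{ij}=\sqrt{r_i^2+r_j^2+2\cos\Phi_{ij}\,r_ir_j}\quad\text{(Euclidean background)},$$ $$l_{ij}=\cosh^{-1}\left(\cosh r_i\cosh r_j+\cos\Phi_{ij}\sinh r_i\sinh r_j\right)\quad\text{(hyperbolic background)}.$$ For a face $\{i,j,k\}\in F$ let $\theta_i^{jk}$ be the inner angle at $i$ of the Euclidean (respectively hyperbolic) triangle with side lengths $l_{ij},l_{jk},l_{ik}$, and let $K_i=2\pi-\sum_{\{i,j,k\}\in F}\theta_i^{jk}$ be the discrete Gaussian curvature at $i$. The combinatorial Ricci flow (CRF) is $$\frac{dr_i}{dt}=-K_i\,r_i\ \ (i\in V)\quad\text{(Euclidean)},\qquad \frac{dr_i}{dt}=-K_i\sinh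 r_i\ \ (i\in V)\quad\text{(hyperbolic)}.$$ **Theorem.** Let $\mathcal T=(V,E,F)$ be an infinite disk triangulation whose vertex degrees are uniformly bounded, and let $\Phi\in[0,\frac{\pi}{2}]^E$. Then, in the Euclidean as well as in the hyperbolic background geometry, for every initial circle-packing metric $r(0)\in(0,\infty)^V$ there exists a solution $r(t)\in(0,\infty)^V$, $t\in[0,\infty)$, of the CRF with this initial value. It is $C^\infty$ in $t\in[0,\infty)$ at each vertex, and it is unique among all differentiable solutions on $[0,\infty)$ with values in $(0,\infty)^V$ (with one-sided derivative at $t=0$); no bound or growth condition on the solutions is assumed. -/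

import Mathlib

open Set
open scoped ContDiff

noncomputable section

namespace CRF

/-! ### Triangulations of the open disk -/

section Triangulation

variable {V : Type*}

/-- The geometric realization of an abstract simplicial complex, in barycentric coordinates:
points are the functions `x : V → ℝ` that are nonnegative, vanish off some simplex, and sum to `1`
on it. It carries the topology of the barycentric coordinates, which coincides with the
weak (CW) topology when the complex is locally finite. -/
def realization (T : AbstractSimplicialComplex V) : Set (V → ℝ) :=
  {x | ∃ s ∈ T.faces, (∀ v, 0 ≤ x v) ∧ (∀ v, v ∉ s → x v = 0) ∧ ∑ v ∈ s, x v = 1}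

/-- Every vertex lies in only finitely many simplices. -/
def IsLocallyFinite (T : AbstractSimplicialComplex V) : Prop :=
  ∀ v, {s ∈ T.faces | v ∈ s}.Finite

/-- A (locally finite) triangulation of the open unit disk. -/
structure IsDiskTriangulation (T : AbstractSimplicialComplex V) : Prop where
  locallyFinite : IsLocallyFinite T
  homeomorphic_disk : Nonempty (realization T ≃ₜ Metric.ball (0 : ℂ) 1)

open Classical in
/-- The `1`-skeleton: `i ∼ j` iff `{i, j}` is an edge of the triangulation. -/
def skeleton (T : AbstractSimplicialComplex V) : SimpleGraph V where
  Adj i j := i ≠ j ∧ ({i, j} : Finset V) ∈ T.faces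
  symm := ⟨fun i j h => ⟨h.1.symm, by rw [Finset.pair_comm]; exact h.2⟩⟩
  loopless := ⟨fun _ h => h.1 rfl⟩

/-- The combinatorial degree of a vertex. -/
def degree (T : AbstractSimplicialComplex V) (i : V) : ℕ∞ :=
  ((skeleton T).neighborSet i).encard

open Classical in
/-- The unordered pairs `{j, k}` such that `{i, j, k}` is a (two-dimensional) face; they correspond
bijectively to the faces containing `i`. -/
def oppositeEdges (T : AbstractSimplicialComplex V) (i : V) : Set (Sym2 V) :=
  {e | ∃ j k, e = s(j, k) ∧ i ≠ j ∧ i ≠ k ∧ j ≠ k ∧ ({i, j, k} : Finset V) ∈ T.faces}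

/-- In a locally finite complex a vertex lies in finitely many faces, so that the angle sum in
the curvature below is a genuine finite sum. -/
theorem oppositeEdges_finite {T : AbstractSimplicialComplex V} (hT : IsLocallyFinite T) (i : V) :
    (oppositeEdges T i).Finite := by
  classical
  refine ((hT i).biUnion (t := fun s => (s.sym2 : Set (Sym2 V)))
    fun s _ => s.sym2.finite_toSet).subset ?_
  rintro e ⟨j, k, rfl, -, -, -, h⟩
  refine Set.mem_biUnion (x := ({i, j, k} : Finset V)) ⟨h, by simp⟩ ?_
  simp

end Triangulation

/-! ### Circle-packing metrics -/

/-- The two background geometries. -/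
inductive Background
  | euclidean
  | hyperbolic

/-- The length of an edge whose end points carry circles of radii `a`, `b` that meet at
intersection angle `φ`. -/
def edgeLength (g : Background) (a b φ : ℝ) : ℝ :=
  match g with
  | .euclidean => √(a ^ 2 + b ^ 2 + 2 * Real.cos φ * a * b)
  | .hyperbolic =>
      Real.arcosh (Real.cosh a * Real.cosh b + Real.cos φ * Real.sinh a * Real.sinh b)

/-- The inner angle, between the sides of lengths `x` and `y`, of the geodesic triangle with side
lengths `x`, `y`, `z` (law of cosines). -/
def innerAngle (g : Background) (x y z : ℝ) : ℝ :=
  match g with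
  | .euclidean => Real.arccos ((x ^ 2 + y ^ 2 - z ^ 2) / (2 * x * y))
  | .hyperbolic =>
      Real.arccos ((Real.cosh x * Real.cosh y - Real.cosh z) / (Real.sinh x * Real.sinh y))

theorem edgeLength_comm (g : Background) (a b φ : ℝ) :
    edgeLength g a b φ = edgeLength g b a φ := by
  cases g <;> simp only [edgeLength] <;> congr 1 <;> ring

theorem innerAngle_comm (g : Background) (x y z : ℝ) :
    innerAngle g x y z = innerAngle g y x z := by
  cases g <;> simp only [innerAngle] <;> congr 1 <;> ring

section Flow

variable {V : Type*}

/-- The length of the edge `{i, j}` for the radii `r` and the intersection angles `Φ`. -/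
def length (g : Background) (Φ : Sym2 V → ℝ) (r : V → ℝ) (i j : V) : ℝ :=
  edgeLength g (r i) (r j) (Φ s(i, j))

/-- The inner angle `θ_i^{jk}` at `i` of the face `{i, j, k}`, as a function of the unordered
pair `{j, k}`. -/
def theta (g : Background) (Φ : Sym2 V → ℝ) (r : V → ℝ) (i : V) : Sym2 V → ℝ :=
  Sym2.lift ⟨fun j k => innerAngle g (length g Φ r i j) (length g Φ r i k) (length g Φ r j k),
    fun j k => by
      have h : length g Φ r j k = length g Φ r k j := by
        simp only [length]
        rw [edgeLength_comm, Sym2.eq_swap]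
      simp only [h, innerAngle_comm g (length g Φ r i j)]⟩

/-- The discrete Gaussian curvature `K_i = 2π - ∑ θ_i^{jk}`, the sum being over all faces
`{i, j, k}` that contain `i`. -/
def curvature (g : Background) (T : AbstractSimplicialComplex V) (Φ : Sym2 V → ℝ) (r : V → ℝ)
    (i : V) : ℝ :=
  2 * Real.pi - ∑ᶠ e ∈ oppositeEdges T i, theta g Φ r i e

/-- The right-hand side of the combinatorial Ricci flow: `-K_i r_i` in Euclidean and
`-K_i sinh r_i` in hyperbolic background geometry. -/
def flowField (g : Background) (T : AbstractSimplicialComplex V) (Φ : Sym2 V → ℝ) (r : V → ℝ)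
    (i : V) : ℝ :=
  match g with
  | .euclidean => -curvature g T Φ r i * r i
  | .hyperbolic => -curvature g T Φ r i * Real.sinh (r i)

/-- `r` is a global solution, on the time interval `[0, ∞)`, of the combinatorial Ricci flow with
initial value `r₀`; the derivative at `t = 0` is one-sided. -/
structure IsSolution (g : Background) (T : AbstractSimplicialComplex V) (Φ : Sym2 V → ℝ)
    (r₀ : V → ℝ) (r : ℝ → V → ℝ) : Prop where
  /-- At every time `r t` is a circle-packing metric. -/
  pos : ∀ t, 0 ≤ t → ∀ i, 0 < r t i
  initial : r 0 = r₀
  flow : ∀ t, 0 ≤ t → ∀ i,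
    HasDerivWithinAt (fun s => r s i) (flowField g T Φ (r t) i) (Ici 0) t

end Flow

end CRF

end

/-! Let `u = log r` in the Euclidean case and `u = log tanh (r/2) = -arsinh (1 / sinh r) < 0` in the
hyperbolic case. Then `du = dr / r`, respectively `du = dr / sinh r`, and the flow becomes `u_i' =
-K_i`. The initial values may be unbounded, but this field is bounded and Lipschitz in the supremum
norm. It is bounded because angles lie in `[0, π]` and bounded degree bounds the number of faces at
a vertex. It is Lipschitz because every angle is a Lipschitz function of the three coordinates `u`
of its face, with an absolute constant (`abs_faceAngle_sub_le`).

This last estimate is the heart of the proof. With `s` the product of the two adjacent sides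
(hyperbolic: of their sinh) times the sine of the angle at `i`, the derivative of that angle in
`u_j` is an explicit nonnegative weight over `l_ij ^ 2 * s` (hyperbolic: `sinh l_ij ^ 2 * s`). Since
`Φ ≤ π/2`, all cosines are nonnegative and `s` can be bounded below by discarding terms. This
controls the weight (`euclideanWeight_le`, `hyperbolicWeight_le`).

Existence is then Picard–Lindelöf for the displacement `u - u₀`, which lies in `ℓ^∞`. For
uniqueness, boundedness of `K` alone keeps two solutions within `2Ct` of each other, and iterating
the Lipschitz bound forces equality. So no growth condition is needed. In the hyperbolic case `u`
must also stay negative: at a vertex of large radius all angles are small, whatever the other radii,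
so `K > 0` there and the radius decreases. Smoothness follows by bootstrapping, since each `K_i`
depends smoothly on finitely many radii. -/

noncomputable section

namespace CRF

/-! ### Ordinary differential equations with a bounded Lipschitz field in the supremum norm -/

section Ode

variable {V : Type*}

/-- On `Ω` the field `G` is bounded by `C` and Lipschitz with constant `L`, in the supremum norm. -/
structure IsUniformField (G : (V → ℝ) → V → ℝ) (Ω : Set (V → ℝ)) (C L : ℝ) : Prop where
  bound : ∀ u ∈ Ω, ∀ i, |G u i| ≤ C
  lipschitz : ∀ u ∈ Ω, ∀ v ∈ Ω, ∀ δ, (∀ j, |u j - v j| ≤ δ) → ∀ i, |G u i - G v i| ≤ L * δ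

/-- Picard iteration applied to a difference of solutions: boundedness of the field starts the
induction without any a priori bound on `u - v`, and each use of the Lipschitz condition gains a
factor `L t / (n + 1)`. -/
theorem IsUniformField.abs_sub_le {G : (V → ℝ) → V → ℝ} {Ω : Set (V → ℝ)} {C L T : ℝ}
    (hG : IsUniformField G Ω C L) {u v : ℝ → V → ℝ}
    (huΩ : ∀ t ∈ Icc 0 T, u t ∈ Ω) (hvΩ : ∀ t ∈ Icc 0 T, v t ∈ Ω)
    (hu : ∀ t ∈ Icc 0 T, ∀ i, HasDerivWithinAt (fun s => u s i) (G (u t) i) (Icc 0 T) t)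
    (hv : ∀ t ∈ Icc 0 T, ∀ i, HasDerivWithinAt (fun s => v s i) (G (v t) i) (Icc 0 T) t)
    (h0 : u 0 = v 0) (n : ℕ) :
    ∀ t ∈ Icc 0 T, ∀ i, |u t i - v t i| ≤ 2 * C * L ^ n * (t ^ (n + 1) / (n + 1).factorial) := by
  have hmain : ∀ n : ℕ, (∀ t ∈ Icc 0 T, ∀ i,
      |G (u t) i - G (v t) i| ≤ 2 * C * L ^ n * (t ^ n / n.factorial)) →
      ∀ t ∈ Icc 0 T, ∀ i,
        |u t i - v t i| ≤ 2 * C * L ^ n * (t ^ (n + 1) / (n + 1).factorial) := by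
    intro n hn t ht i
    have hd : ∀ s ∈ Icc 0 T, HasDerivWithinAt (fun s => u s i - v s i)
        (G (u s) i - G (v s) i) (Icc 0 T) s := fun s hs => (hu s hs i).sub (hv s hs i)
    refine image_norm_le_of_norm_deriv_right_le_deriv_boundary
      (f := fun s => u s i - v s i) (f' := fun s => G (u s) i - G (v s) i)
      (B := fun t => 2 * C * L ^ n * (t ^ (n + 1) / (n + 1).factorial))
      (B' := fun t => 2 * C * L ^ n * (t ^ n / n.factorial))
      (fun s hs => (hd s hs).continuousWithinAt)
      (fun s hs => (hd s (Ico_subset_Icc_self hs)).mono_of_mem_nhdsWithin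
        (Icc_mem_nhdsGE_of_mem hs)) (by simp [h0]) (fun s => ?_)
      (fun s hs => hn s (Ico_subset_Icc_self hs) i) ht
    have h := ((hasDerivAt_pow (n + 1) s).div_const ((n + 1).factorial : ℝ)).const_mul
      (2 * C * L ^ n)
    refine h.congr_deriv ?_
    rw [Nat.factorial_succ]
    have := Nat.factorial_ne_zero n
    push_cast
    field_simp
  induction n with
  | zero =>
    refine hmain 0 fun t ht i => ?_
    have h1 := hG.bound _ (huΩ t ht) i
    have h2 := hG.bound _ (hvΩ t ht) i
    have h3 := abs_sub (G (u t) i) (G (v t) i)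
    simp
    linarith
  | succ n ih =>
    refine hmain (n + 1) fun t ht i => ?_
    refine (hG.lipschitz _ (huΩ t ht) _ (hvΩ t ht) _ (ih t ht) i).trans_eq ?_
    ring

theorem IsUniformField.eq_of_hasDerivWithinAt {G : (V → ℝ) → V → ℝ} {Ω : Set (V → ℝ)}
    {C L T : ℝ} (hG : IsUniformField G Ω C L) {u v : ℝ → V → ℝ}
    (huΩ : ∀ t ∈ Icc 0 T, u t ∈ Ω) (hvΩ : ∀ t ∈ Icc 0 T, v t ∈ Ω)
    (hu : ∀ t ∈ Icc 0 T, ∀ i, HasDerivWithinAt (fun s => u s i) (G (u t) i) (Icc 0 T) t)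
    (hv : ∀ t ∈ Icc 0 T, ∀ i, HasDerivWithinAt (fun s => v s i) (G (v t) i) (Icc 0 T) t)
    (h0 : u 0 = v 0) : ∀ t ∈ Icc 0 T, u t = v t := by
  intro t ht
  funext i
  have h1 : Filter.Tendsto (fun n : ℕ => 2 * C * t * ((|L| * t) ^ n / n.factorial))
      Filter.atTop (nhds (2 * C * t * 0)) :=
    (FloorSemiring.tendsto_pow_div_factorial_atTop (|L| * t)).const_mul _
  have hC : 0 ≤ C := (abs_nonneg _).trans (hG.bound _ (huΩ t ht) i)
  have h2 : |u t i - v t i| ≤ 2 * C * t * 0 := by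
    refine ge_of_tendsto' h1 fun n => (hG.abs_sub_le huΩ hvΩ hu hv h0 n t ht i).trans ?_
    have hL : L ^ n ≤ |L| ^ n := by rw [← abs_pow]; exact le_abs_self _
    have ht0 := ht.1
    calc 2 * C * L ^ n * (t ^ (n + 1) / (n + 1).factorial)
        ≤ 2 * C * |L| ^ n * (t ^ (n + 1) / n.factorial) := by
          gcongr
          exact n.le_succ
      _ = _ := by ring
  rw [mul_zero] at h2
  exact sub_eq_zero.1 (abs_nonpos_iff.1 h2)

/-- The initial value need not be bounded, so Picard–Lindelöf is applied in `ℓ^∞` to the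
displacement `u - u₀`, starting at `0`. Since speed is at most `C`, the ball of radius `C * T`
suffices for the whole interval. -/
theorem IsUniformField.exists_hasDerivWithinAt_Icc {G : (V → ℝ) → V → ℝ} {C L : ℝ}
    (hG : IsUniformField G univ C L) (hC : 0 ≤ C) (hL : 0 ≤ L) (u₀ : V → ℝ) {T : ℝ}
    (hT : 0 ≤ T) : ∃ u : ℝ → V → ℝ, u 0 = u₀ ∧
      ∀ t ∈ Icc 0 T, ∀ i, HasDerivWithinAt (fun s => u s i) (G (u t) i) (Icc 0 T) t := by
  let E := lp (fun _ : V => ℝ) ⊤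
  let F : E → E := fun w => ⟨fun i => G (fun j => u₀ j + w j) i, memℓp_infty
    ⟨C, by rintro _ ⟨i, rfl⟩; exact hG.bound _ (mem_univ _) i⟩⟩
  have hF : ∀ w, ‖F w‖ ≤ C := fun w =>
    lp.norm_le_of_forall_le hC fun i => hG.bound _ (mem_univ _) i
  have hFL : ∀ w w', ‖F w - F w'‖ ≤ L * ‖w - w'‖ := fun w w' => by
    refine lp.norm_le_of_forall_le (by positivity) fun i => ?_
    refine hG.lipschitz _ (mem_univ _) _ (mem_univ _) _ (fun j => ?_) i
    have := lp.norm_apply_le_norm ENNReal.top_ne_zero (w - w') j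
    simpa using this
  have hpl : IsPicardLindelof (fun _ : ℝ => F) (tmin := 0) (tmax := T) ⟨0, le_rfl, hT⟩ (0 : E)
      ⟨C * T, by positivity⟩ 0 ⟨C, hC⟩ ⟨L, hL⟩ := by
    refine IsPicardLindelof.of_time_independent (fun w _ => hF w) ?_ ?_
    · exact (LipschitzWith.of_dist_le_mul fun w w' => by
        rw [dist_eq_norm, dist_eq_norm]; exact hFL w w').lipschitzOnWith
    · simp only [sub_zero, sub_self, NNReal.coe_zero, max_eq_left hT]
      exact le_rfl
  obtain ⟨α, hα0, hα⟩ := hpl.exists_eq_forall_mem_Icc_hasDerivWithinAt₀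
  refine ⟨fun t i => u₀ i + α t i, ?_, fun t ht i => ?_⟩
  · funext i
    simp [show α 0 = 0 from hα0]
  · have h := (lp.evalCLM ℝ (fun _ : V => ℝ) ⊤ i).hasFDerivAt.comp_hasDerivWithinAt t (hα t ht)
    exact h.const_add (u₀ i)

theorem IsUniformField.exists_hasDerivWithinAt_Ici {G : (V → ℝ) → V → ℝ} {C L : ℝ}
    (hG : IsUniformField G univ C L) (hC : 0 ≤ C) (hL : 0 ≤ L) (u₀ : V → ℝ) :
    ∃ u : ℝ → V → ℝ, u 0 = u₀ ∧
      ∀ t, 0 ≤ t → ∀ i, HasDerivWithinAt (fun s => u s i) (G (u t) i) (Ici 0) t := by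
  choose w hw0 hw using fun n : ℕ =>
    hG.exists_hasDerivWithinAt_Icc hC hL u₀ (Nat.cast_nonneg (α := ℝ) n)
  have hagree : ∀ m n : ℕ, m ≤ n → ∀ t ∈ Icc (0 : ℝ) m, w m t = w n t := by
    intro m n hmn
    have hsub : Icc (0 : ℝ) m ⊆ Icc 0 n := Icc_subset_Icc_right (by exact_mod_cast hmn)
    exact hG.eq_of_hasDerivWithinAt (fun _ _ => mem_univ _) (fun _ _ => mem_univ _) (hw m)
      (fun t ht i => (hw n t (hsub ht) i).mono hsub) (by rw [hw0, hw0])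
  have hsol : ∀ n : ℕ, ∀ t ∈ Icc (0 : ℝ) n, w ⌈t⌉₊ t = w n t := fun n t ht =>
    hagree _ _ (Nat.ceil_le.2 ht.2) t ⟨ht.1, Nat.le_ceil t⟩
  -- By uniqueness the solutions on `[0, n]` extend each other; at time `t` the one on `[0, ⌈t⌉₊]`
  -- is read off.
  refine ⟨fun t => w ⌈t⌉₊ t, by simp [hw0], fun t ht i => ?_⟩
  obtain ⟨n, hn⟩ := exists_nat_gt t
  have hmem : t ∈ Icc (0 : ℝ) n := ⟨ht, hn.le⟩
  have hnhds : Icc (0 : ℝ) n ∈ nhdsWithin t (Ici 0) := by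
    rw [← Ici_inter_Iic]
    exact inter_mem_nhdsWithin _ (Iic_mem_nhds hn)
  refine HasDerivWithinAt.mono_of_mem_nhdsWithin (t := Icc (0 : ℝ) n) ?_ hnhds
  simp only [hsol n t hmem]
  exact (hw n t hmem i).congr (fun s hs => by rw [hsol n s hs]) (by rw [hsol n t hmem])

end Ode

/-! ### Inner angles as functions of the radii -/

section Angle

theorem neg_one_lt_div_sqrt {p q : ℝ} (h : p ^ 2 < q) : -1 < p / √q ∧ p / √q < 1 := by
  have hq : 0 < √q := Real.sqrt_pos.2 ((sq_nonneg p).trans_lt h)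
  have h' : |p| < √q := by
    rw [← Real.sqrt_sq_eq_abs]
    exact Real.sqrt_lt_sqrt (sq_nonneg p) h
  rw [lt_div_iff₀ hq, div_lt_iff₀ hq]
  constructor <;> linarith [(abs_lt.1 h').1, (abs_lt.1 h').2]

/-- The denominator is arranged as `√(q - p ^ 2)` because `q - p ^ 2` is the Gram expression in both
geometries. -/
theorem hasDerivWithinAt_arccos_div_sqrt {p q : ℝ → ℝ} {p' q' t : ℝ} {S : Set ℝ}
    (hp : HasDerivWithinAt p p' S t) (hq : HasDerivWithinAt q q' S t) (h : p t ^ 2 < q t) :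
    HasDerivWithinAt (fun s => Real.arccos (p s / √(q s)))
      (-(p' - p t * q' / (2 * q t)) / √(q t - p t ^ 2)) S t := by
  have hq0 : 0 < q t := (sq_nonneg _).trans_lt h
  have hs : 0 < √(q t) := Real.sqrt_pos.2 hq0
  have hlt := neg_one_lt_div_sqrt h
  have h1 := (Real.hasDerivAt_arccos hlt.1.ne' hlt.2.ne).comp_hasDerivWithinAt t
    (hp.div (hq.sqrt hq0.ne') hs.ne')
  refine h1.congr_deriv ?_
  have h2 : √(1 - (p t / √(q t)) ^ 2) = √(q t - p t ^ 2) / √(q t) := by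
    rw [← Real.sqrt_div (by linarith), div_pow, Real.sq_sqrt hq0.le]
    congr 1
    field_simp
  have h3 : 0 < √(q t - p t ^ 2) := Real.sqrt_pos.2 (by linarith)
  rw [h2]
  have h4 : q t = √(q t) ^ 2 := (Real.sq_sqrt hq0.le).symm
  generalize √(q t - p t ^ 2) = d at *
  generalize √(q t) = r at *
  rw [h4]
  field_simp

theorem contDiffOn_arccos_div_sqrt {p q : ℝ → ℝ} {S : Set ℝ} {n : WithTop ℕ∞}
    (hp : ContDiffOn ℝ n p S) (hq : ContDiffOn ℝ n q S) (h : ∀ t ∈ S, p t ^ 2 < q t) :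
    ContDiffOn ℝ n (fun s => Real.arccos (p s / √(q s))) S := by
  intro t ht
  have hq0 : 0 < q t := (sq_nonneg _).trans_lt (h t ht)
  have hlt := neg_one_lt_div_sqrt (h t ht)
  exact ContDiffAt.comp_contDiffWithinAt (g := Real.arccos) (f := fun s => p s / √(q s)) t
    (Real.contDiffAt_arccos hlt.1.ne' hlt.2.ne) ((hp t ht).div ((hq t ht).sqrt hq0.ne')
      (Real.sqrt_pos.2 hq0).ne')

/-! #### Euclidean background -/

/-- The squared product of two sides times the squared sine of their angle. -/
def euclideanGram (α β γ a b c : ℝ) : ℝ :=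
  (a * b) ^ 2 * (1 - γ ^ 2) + (a * c) ^ 2 * (1 - β ^ 2) + (b * c) ^ 2 * (1 - α ^ 2) +
    2 * (a * b * c) * (c * (γ + α * β) + b * (β + α * γ) + a * (α + β * γ))

/-- The nonnegative factor in the derivative of the angle at the circle of radius `a` with respect
to `log b`. -/
def euclideanWeight (α β γ a b c : ℝ) : ℝ :=
  a * b * (1 - γ ^ 2) + c * (a * (α + β * γ) + b * (β + α * γ))

theorem euclideanGram_pos {α β γ a b c : ℝ} (hα : α ∈ Icc (0 : ℝ) 1) (hβ : β ∈ Icc (0 : ℝ) 1)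
    (hγ : γ ∈ Icc (0 : ℝ) 1) (ha : 0 < a) (hb : 0 < b) (hc : 0 < c) :
    0 < euclideanGram α β γ a b c := by
  obtain ⟨hα0, hα1⟩ := hα
  obtain ⟨hβ0, hβ1⟩ := hβ
  obtain ⟨hγ0, hγ1⟩ := hγ
  have h1 : 0 ≤ 1 - γ ^ 2 := by nlinarith
  have h2 : 0 ≤ 1 - β ^ 2 := by nlinarith
  have h3 : 0 ≤ 1 - α ^ 2 := by nlinarith
  unfold euclideanGram
  -- All terms are nonnegative. The first is positive if `γ = 0`, and the one containing `c * γ` is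
  -- positive otherwise.
  rcases hγ0.eq_or_lt with h | h
  · subst h
    have : 0 < (a * b) ^ 2 * (1 - (0 : ℝ) ^ 2) := by positivity
    positivity
  · positivity

/-- The root of the Gram expression dominates both `a * b * (1 - γ ^ 2)` and, as `a` is the smaller
radius, `a * c`. These absorb the two parts of the weight at a cost of `b ^ 2` and `4 * b ^ 2`; the
constant `16` leaves room to match the hyperbolic case. -/
theorem euclideanWeight_le_of_le {α β γ a b c : ℝ} (hα : α ∈ Icc (0 : ℝ) 1)
    (hβ : β ∈ Icc (0 : ℝ) 1) (hγ : γ ∈ Icc (0 : ℝ) 1) (ha : 0 < a) (hb : 0 < b) (hc : 0 < c)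
    (hab : a ≤ b) :
    a * b * euclideanWeight α β γ a b c ≤
      16 * (a ^ 2 + b ^ 2 + 2 * γ * a * b) * √(euclideanGram α β γ a b c) := by
  obtain ⟨hα0, hα1⟩ := hα
  obtain ⟨hβ0, hβ1⟩ := hβ
  obtain ⟨hγ0, hγ1⟩ := hγ
  have h1 : 0 ≤ 1 - γ ^ 2 := by nlinarith
  have h2 : 0 ≤ 1 - β ^ 2 := by nlinarith
  have h3 : 0 ≤ 1 - α ^ 2 := by nlinarith
  have hD1 : a * b * (1 - γ ^ 2) ≤ √(euclideanGram α β γ a b c) := by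
    apply Real.le_sqrt_of_sq_le
    have e1 : (a * b * (1 - γ ^ 2)) ^ 2 ≤ (a * b) ^ 2 * (1 - γ ^ 2) := by
      have : (1 - γ ^ 2) ^ 2 ≤ 1 - γ ^ 2 := by nlinarith [sq_nonneg γ]
      rw [mul_pow]
      gcongr
    have e2 : 0 ≤ (a * c) ^ 2 * (1 - β ^ 2) + (b * c) ^ 2 * (1 - α ^ 2) +
        2 * (a * b * c) * (c * (γ + α * β) + b * (β + α * γ) + a * (α + β * γ)) := by positivity
    unfold euclideanGram
    linarith
  -- The terms with `1 - β ^ 2`, `1 - α ^ 2` and `α * β` together give at least `(a * c) ^ 2 * (2 -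
  -- (α - β) ^ 2)`, and `|α - β| ≤ 1`.
  have hD2 : a * c ≤ √(euclideanGram α β γ a b c) := by
    apply Real.le_sqrt_of_sq_le
    have e1 : (a * c) ^ 2 * (1 - α ^ 2) ≤ (b * c) ^ 2 * (1 - α ^ 2) := by gcongr
    have e2 : (a * c) ^ 2 * (α * β) ≤ a * b * c * (c * (α * β)) := by
      have : a * c * (a * c) ≤ a * c * (b * c) := by gcongr
      nlinarith [mul_nonneg hα0 hβ0]
    have e3 : 0 ≤ (a * c) ^ 2 * (1 - (α - β) ^ 2) := by
      have : 0 ≤ 1 - (α - β) ^ 2 := by nlinarith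
      positivity
    have e4 : 0 ≤ (a * b) ^ 2 * (1 - γ ^ 2) +
        2 * (a * b * c) * (c * γ + b * (β + α * γ) + a * (α + β * γ)) := by positivity
    unfold euclideanGram
    linarith
  have hs := Real.sqrt_nonneg (euclideanGram α β γ a b c)
  unfold euclideanWeight
  generalize √(euclideanGram α β γ a b c) = s at *
  have f1 : a * b * (a * b * (1 - γ ^ 2)) ≤ a * b * s := by gcongr
  have f2 : a * (α + β * γ) + b * (β + α * γ) ≤ 4 * b := by
    have : α + β * γ ≤ 2 := by nlinarith
    have : β + α * γ ≤ 2 := by nlinarith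
    nlinarith
  have f3 : a * c * (b * (a * (α + β * γ) + b * (β + α * γ))) ≤ s * (b * (4 * b)) := by
    gcongr
  have f4 : a * b * s ≤ b * b * s := by gcongr
  have f5 : 0 ≤ (a ^ 2 + 2 * γ * a * b) * s := by positivity
  have f6 : 0 ≤ b ^ 2 * s := by positivity
  linarith

theorem euclideanGram_swap (α β γ a b c : ℝ) :
    euclideanGram β α γ b a c = euclideanGram α β γ a b c := by
  unfold euclideanGram; ring

theorem euclideanWeight_swap (α β γ a b c : ℝ) :
    euclideanWeight β α γ b a c = euclideanWeight α β γ a b c := by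
  unfold euclideanWeight; ring

theorem euclideanGram_swap' (α β γ a b c : ℝ) :
    euclideanGram α γ β a c b = euclideanGram α β γ a b c := by
  unfold euclideanGram; ring

theorem euclideanWeight_nonneg {α β γ a b c : ℝ} (hα : α ∈ Icc (0 : ℝ) 1)
    (hβ : β ∈ Icc (0 : ℝ) 1) (hγ : γ ∈ Icc (0 : ℝ) 1) (ha : 0 < a) (hb : 0 < b) (hc : 0 < c) :
    0 ≤ euclideanWeight α β γ a b c := by
  obtain ⟨hα0, -⟩ := hα
  obtain ⟨hβ0, -⟩ := hβ
  obtain ⟨hγ0, hγ1⟩ := hγ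
  have h1 : 0 ≤ 1 - γ ^ 2 := by nlinarith
  unfold euclideanWeight
  positivity

theorem euclideanWeight_le {α β γ a b c : ℝ} (hα : α ∈ Icc (0 : ℝ) 1)
    (hβ : β ∈ Icc (0 : ℝ) 1) (hγ : γ ∈ Icc (0 : ℝ) 1) (ha : 0 < a) (hb : 0 < b) (hc : 0 < c) :
    a * b * euclideanWeight α β γ a b c ≤
      16 * (a ^ 2 + b ^ 2 + 2 * γ * a * b) * √(euclideanGram α β γ a b c) := by
  rcases le_total a b with h | h
  · exact euclideanWeight_le_of_le hα hβ hγ ha hb hc h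
  · have := euclideanWeight_le_of_le hβ hα hγ hb ha hc h
    rw [euclideanGram_swap, euclideanWeight_swap] at this
    linarith

theorem abs_div_le_of_weight {w x s κ e δ : ℝ} (hw : 0 ≤ w) (hx : 0 < x) (hs : 0 < s)
    (hwx : w ≤ κ * x * s) (he : |e| ≤ δ) : |w / (x * s) * e| ≤ κ * δ := by
  rw [abs_mul, abs_of_nonneg (by positivity)]
  have : w / (x * s) ≤ κ := by
    rw [div_le_iff₀ (by positivity)]
    linarith
  have h0 : 0 ≤ w / (x * s) := by positivity
  exact mul_le_mul this he (abs_nonneg _) (h0.trans this)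

/-- The cosine of the angle, times the product of the adjacent sides. -/
def euclideanNum (α β γ a b c : ℝ) : ℝ := a ^ 2 + γ * a * b + β * a * c - α * b * c

/-- The squared product of the sides adjacent to an angle. -/
def euclideanDen (β γ a b c : ℝ) : ℝ :=
  (a ^ 2 + b ^ 2 + 2 * γ * a * b) * (a ^ 2 + c ^ 2 + 2 * β * a * c)

theorem euclideanDen_sub (α β γ a b c : ℝ) :
    euclideanDen β γ a b c - euclideanNum α β γ a b c ^ 2 = euclideanGram α β γ a b c := by
  unfold euclideanDen euclideanNum euclideanGram; ring

theorem innerAngle_euclidean {a b c φ χ ψ : ℝ} (ha : 0 < a) (hb : 0 < b) (hc : 0 < c)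
    (hφ : 0 ≤ Real.cos φ) (hχ : 0 ≤ Real.cos χ) (hψ : 0 ≤ Real.cos ψ) :
    innerAngle .euclidean (edgeLength .euclidean a b φ) (edgeLength .euclidean a c χ)
      (edgeLength .euclidean b c ψ) =
    Real.arccos (euclideanNum (Real.cos ψ) (Real.cos χ) (Real.cos φ) a b c /
      √(euclideanDen (Real.cos χ) (Real.cos φ) a b c)) := by
  simp only [innerAngle, edgeLength]
  rw [Real.sq_sqrt (by positivity), Real.sq_sqrt (by positivity), Real.sq_sqrt (by positivity),
    mul_assoc (2 : ℝ) (√_) (√_), ← Real.sqrt_mul (by positivity)]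
  congr 1
  unfold euclideanDen
  rw [← mul_div_mul_left (euclideanNum _ _ _ a b c) _ (two_ne_zero' ℝ)]
  congr 1
  unfold euclideanNum
  ring

/-- Here `da`, `db`, `dc` are logarithmic velocities. Only their differences enter, because angles
are invariant under scaling. -/
theorem hasDerivWithinAt_euclideanAngle {α β γ t da db dc : ℝ} {a b c : ℝ → ℝ} {S : Set ℝ}
    (hα : α ∈ Icc (0 : ℝ) 1) (hβ : β ∈ Icc (0 : ℝ) 1) (hγ : γ ∈ Icc (0 : ℝ) 1)
    (ha0 : 0 < a t) (hb0 : 0 < b t) (hc0 : 0 < c t)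
    (ha : HasDerivWithinAt a (a t * da) S t) (hb : HasDerivWithinAt b (b t * db) S t)
    (hc : HasDerivWithinAt c (c t * dc) S t) :
    HasDerivWithinAt
      (fun s => Real.arccos (euclideanNum α β γ (a s) (b s) (c s) /
        √(euclideanDen β γ (a s) (b s) (c s))))
      (a t * b t * euclideanWeight α β γ (a t) (b t) (c t) /
          ((a t ^ 2 + b t ^ 2 + 2 * γ * a t * b t) * √(euclideanGram α β γ (a t) (b t) (c t))) *
          (db - da) +
        a t * c t * euclideanWeight α γ β (a t) (c t) (b t) /
          ((a t ^ 2 + c t ^ 2 + 2 * β * a t * c t) * √(euclideanGram α β γ (a t) (b t) (c t))) *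
          (dc - da)) S t := by
  have hD := euclideanGram_pos hα hβ hγ ha0 hb0 hc0
  have hβ0 := hβ.1
  have hγ0 := hγ.1
  have hpq := euclideanDen_sub α β γ (a t) (b t) (c t)
  have hp : HasDerivWithinAt (fun s => euclideanNum α β γ (a s) (b s) (c s)) _ S t :=
    (((ha.pow 2).add ((ha.const_mul γ).mul hb)).add ((ha.const_mul β).mul hc)).sub
      ((hb.const_mul α).mul hc)
  have hq : HasDerivWithinAt (fun s => euclideanDen β γ (a s) (b s) (c s)) _ S t :=
    (((ha.pow 2).add (hb.pow 2)).add ((ha.const_mul (2 * γ)).mul hb)).mul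
      (((ha.pow 2).add (hc.pow 2)).add ((ha.const_mul (2 * β)).mul hc))
  have h := hasDerivWithinAt_arccos_div_sqrt hp hq (by linarith)
  refine h.congr_deriv ?_
  rw [hpq]
  have hs : 0 < √(euclideanGram α β γ (a t) (b t) (c t)) := Real.sqrt_pos.2 hD
  simp only [Pi.add_apply, Pi.mul_apply, Pi.pow_apply, euclideanDen]
  generalize a t = a at *
  generalize b t = b at *
  generalize c t = c at *
  generalize √(euclideanGram α β γ a b c) = s at *
  have hx : 0 < a ^ 2 + b ^ 2 + 2 * γ * a * b := by positivity
  have hy : 0 < a ^ 2 + c ^ 2 + 2 * β * a * c := by positivity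
  obtain ⟨x, hxe⟩ : ∃ x, x = a ^ 2 + b ^ 2 + 2 * γ * a * b := ⟨_, rfl⟩
  obtain ⟨y, hye⟩ : ∃ y, y = a ^ 2 + c ^ 2 + 2 * β * a * c := ⟨_, rfl⟩
  rw [← hxe] at hx ⊢
  rw [← hye] at hy ⊢
  field_simp
  rw [hxe, hye]
  unfold euclideanNum euclideanWeight
  push_cast
  ring

end Angle

section HyperbolicAngle

/-! #### Hyperbolic background

In the algebraic lemmas `A`, `B`, `C` are the hyperbolic cosines and `a`, `b`, `c` the hyperbolic
sines of the radii. -/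

/-- The hyperbolic cosine of a side. -/
def coshSide (γ A B a b : ℝ) : ℝ := A * B + γ * a * b

/-- The hyperbolic counterpart of `euclideanGram`. -/
def hyperbolicGram (α β γ A B C a b c : ℝ) : ℝ :=
  (a * b) ^ 2 * (1 - γ ^ 2) + (a * c) ^ 2 * (1 - β ^ 2) + (b * c) ^ 2 * (1 - α ^ 2) +
    2 * (a * b * c) ^ 2 * (1 + α * β * γ) +
    2 * (a * b * c) * (c * A * B * (γ + α * β) + b * A * C * (β + α * γ) +
      a * B * C * (α + β * γ))

/-- The hyperbolic counterpart of `euclideanWeight`. -/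
def hyperbolicWeight (α β γ A B C a b c : ℝ) : ℝ :=
  a * b * C * (1 - γ ^ 2) + c * (a * B * (α + β * γ) + b * A * (β + α * γ))

/-- The cosine of the angle, times the hyperbolic sines of the adjacent sides. -/
def hyperbolicNum (α β γ A B C a b c : ℝ) : ℝ :=
  coshSide γ A B a b * coshSide β A C a c - coshSide α B C b c

/-- The squared product of the hyperbolic sines of the sides adjacent to an angle. -/
def hyperbolicDen (β γ A B C a b c : ℝ) : ℝ :=
  (coshSide γ A B a b ^ 2 - 1) * (coshSide β A C a c ^ 2 - 1)

theorem hyperbolicDen_sub {α β γ A B C a b c : ℝ} (hA : A ^ 2 = a ^ 2 + 1)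
    (hB : B ^ 2 = b ^ 2 + 1) (hC : C ^ 2 = c ^ 2 + 1) :
    hyperbolicDen β γ A B C a b c - hyperbolicNum α β γ A B C a b c ^ 2 =
      hyperbolicGram α β γ A B C a b c := by
  have hAB : A ^ 2 * B ^ 2 = (a ^ 2 + 1) * (b ^ 2 + 1) := by rw [hA, hB]
  have hAC : A ^ 2 * C ^ 2 = (a ^ 2 + 1) * (c ^ 2 + 1) := by rw [hA, hC]
  have hBC : B ^ 2 * C ^ 2 = (b ^ 2 + 1) * (c ^ 2 + 1) := by rw [hB, hC]
  have hABC : A ^ 2 * B ^ 2 * C ^ 2 = (a ^ 2 + 1) * (b ^ 2 + 1) * (c ^ 2 + 1) := by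
    rw [hA, hB, hC]
  unfold hyperbolicDen hyperbolicNum hyperbolicGram coshSide
  linear_combination 2 * hABC - hAB - hAC - hBC + 2 * γ * a * b * A * B * hC +
    2 * β * a * c * A * C * hB + 2 * α * b * c * B * C * hA

theorem hyperbolicGram_swap (α β γ A B C a b c : ℝ) :
    hyperbolicGram β α γ B A C b a c = hyperbolicGram α β γ A B C a b c := by
  unfold hyperbolicGram; ring

theorem hyperbolicGram_swap' (α β γ A B C a b c : ℝ) :
    hyperbolicGram α γ β A C B a c b = hyperbolicGram α β γ A B C a b c := by
  unfold hyperbolicGram; ring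

theorem hyperbolicWeight_swap (α β γ A B C a b c : ℝ) :
    hyperbolicWeight β α γ B A C b a c = hyperbolicWeight α β γ A B C a b c := by
  unfold hyperbolicWeight; ring

theorem coshSide_swap (γ A B a b : ℝ) : coshSide γ B A b a = coshSide γ A B a b := by
  unfold coshSide; ring

theorem one_lt_coshSide {γ A B a b : ℝ} (hγ : 0 ≤ γ) (hA : 1 < A) (hB : 1 < B) (ha : 0 < a)
    (hb : 0 < b) : 1 < coshSide γ A B a b := by
  unfold coshSide
  have : 0 ≤ γ * a * b := by positivity
  nlinarith

theorem hyperbolicGram_pos {α β γ A B C a b c : ℝ} (hα : α ∈ Icc (0 : ℝ) 1)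
    (hβ : β ∈ Icc (0 : ℝ) 1) (hγ : γ ∈ Icc (0 : ℝ) 1) (hA : 0 < A) (hB : 0 < B) (hC : 0 < C)
    (ha : 0 < a) (hb : 0 < b) (hc : 0 < c) : 0 < hyperbolicGram α β γ A B C a b c := by
  obtain ⟨hα0, hα1⟩ := hα
  obtain ⟨hβ0, hβ1⟩ := hβ
  obtain ⟨hγ0, hγ1⟩ := hγ
  have h1 : 0 ≤ 1 - γ ^ 2 := by nlinarith
  have h2 : 0 ≤ 1 - β ^ 2 := by nlinarith
  have h3 : 0 ≤ 1 - α ^ 2 := by nlinarith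
  unfold hyperbolicGram
  positivity

theorem hyperbolicWeight_nonneg {α β γ A B C a b c : ℝ} (hα : α ∈ Icc (0 : ℝ) 1)
    (hβ : β ∈ Icc (0 : ℝ) 1) (hγ : γ ∈ Icc (0 : ℝ) 1) (hA : 0 < A) (hB : 0 < B) (hC : 0 < C)
    (ha : 0 < a) (hb : 0 < b) (hc : 0 < c) : 0 ≤ hyperbolicWeight α β γ A B C a b c := by
  obtain ⟨hα0, -⟩ := hα
  obtain ⟨hβ0, -⟩ := hβ
  obtain ⟨hγ0, hγ1⟩ := hγ
  have h1 : 0 ≤ 1 - γ ^ 2 := by nlinarith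
  unfold hyperbolicWeight
  positivity

theorem sinh_mul_sinh_le {A B a b : ℝ} (hA : A ^ 2 = a ^ 2 + 1) (hB : B ^ 2 = b ^ 2 + 1)
    (hA1 : 1 < A) (hB1 : 1 < B) (ha : 0 < a) (hb : 0 < b) : a * b ≤ A * B - 1 := by
  have : a * b + 1 ≤ A * B := by
    rw [← sq_le_sq₀ (by positivity) (by positivity), mul_pow, hA, hB]
    nlinarith [sq_nonneg (a - b)]
  linarith

theorem sinh_mul_cosh_le {A B a b : ℝ} (hA : A ^ 2 = a ^ 2 + 1) (hB : B ^ 2 = b ^ 2 + 1)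
    (hA1 : 1 < A) (hB1 : 1 < B) (ha : 0 < a) (hab : a ≤ b) : a * B ≤ b * A := by
  have hb := ha.trans_le hab
  rw [← sq_le_sq₀ (by positivity) (by positivity), mul_pow, mul_pow, hA, hB]
  nlinarith

/-- Two regimes. For `b ≤ 1` the geometry is nearly Euclidean: `a * c ≤ s` is used with `A, B ≤
3/2`, and `15 = 4 * (3/2) * (5/2)`. For `b ≥ 1` one has `b ≤ 3 * (B - 1)`, and `a * b * c ≤ s`
suffices with constant `12`. -/
theorem sinh_mul_sinh_mul_sinh_le {A B a b c s : ℝ} (hA : A ^ 2 = a ^ 2 + 1)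
    (hB : B ^ 2 = b ^ 2 + 1) (hA1 : 1 < A) (hB1 : 1 < B) (ha : 0 < a) (hb : 0 < b)
    (hc : 0 < c) (hs : 0 ≤ s) (hac : a * c ≤ s) (habc : a * b * c ≤ s) (hab : a ≤ b) :
    a * b * c * (4 * (b * A)) ≤ 15 * (A * B - 1) * s := by
  have hBb : B ≤ 1 + b := by nlinarith
  rcases le_total b 1 with hb1 | hb1
  · have hA2 : A ≤ 3 / 2 := by nlinarith
    have hB2 : B ≤ 3 / 2 := by nlinarith
    have g1 : b ^ 2 ≤ 5 / 2 * (A * B - 1) := by nlinarith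
    calc a * b * c * (4 * (b * A)) = 4 * b ^ 2 * A * (a * c) := by ring
      _ ≤ 4 * b ^ 2 * (3 / 2) * s := by gcongr
      _ = 6 * b ^ 2 * s := by ring
      _ ≤ 6 * (5 / 2 * (A * B - 1)) * s := by gcongr
      _ = _ := by ring
  · have g0 : b ≤ 3 * (B - 1) := by nlinarith
    have g1 : b * A ≤ 3 * (A * B - 1) := by nlinarith
    calc a * b * c * (4 * (b * A)) ≤ s * (4 * (3 * (A * B - 1))) := by gcongr
      _ ≤ _ := by
        have : 0 ≤ (A * B - 1) * s := mul_nonneg (by nlinarith) hs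
        linarith

/-- As in the Euclidean case, with the further lower bound `a * b * c` for the root of the Gram
expression, needed for large radii. The constant is `16 = 1 + 15`, one summand for each part of the
weight. -/
theorem hyperbolicWeight_le_of_le {α β γ A B C a b c : ℝ} (hα : α ∈ Icc (0 : ℝ) 1)
    (hβ : β ∈ Icc (0 : ℝ) 1) (hγ : γ ∈ Icc (0 : ℝ) 1) (hA : A ^ 2 = a ^ 2 + 1)
    (hB : B ^ 2 = b ^ 2 + 1) (hC : C ^ 2 = c ^ 2 + 1) (hA1 : 1 < A) (hB1 : 1 < B) (hC1 : 1 < C)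
    (ha : 0 < a) (hb : 0 < b) (hc : 0 < c) (hab : a ≤ b) :
    a * b * hyperbolicWeight α β γ A B C a b c ≤
      16 * (coshSide γ A B a b - 1) * √(hyperbolicGram α β γ A B C a b c) := by
  obtain ⟨hα0, hα1⟩ := hα
  obtain ⟨hβ0, hβ1⟩ := hβ
  obtain ⟨hγ0, hγ1⟩ := hγ
  have h1 : 0 ≤ 1 - γ ^ 2 := by nlinarith
  have h2 : 0 ≤ 1 - β ^ 2 := by nlinarith
  have h3 : 0 ≤ 1 - α ^ 2 := by nlinarith
  have hD1 : a * b * C * (1 - γ ^ 2) ≤ √(hyperbolicGram α β γ A B C a b c) := by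
    apply Real.le_sqrt_of_sq_le
    have e1 : (a * b * C * (1 - γ ^ 2)) ^ 2 ≤
        (a * b) ^ 2 * (1 - γ ^ 2) + (a * b * c) ^ 2 * 1 := by
      have e0 : (1 - γ ^ 2) ^ 2 ≤ 1 - γ ^ 2 := by nlinarith [sq_nonneg γ]
      have e0' : (1 - γ ^ 2) ^ 2 ≤ 1 := by nlinarith [sq_nonneg γ]
      have : (a * b * C * (1 - γ ^ 2)) ^ 2 =
          (a * b) ^ 2 * (1 - γ ^ 2) ^ 2 + (a * b * c) ^ 2 * (1 - γ ^ 2) ^ 2 := by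
        rw [mul_pow, mul_pow _ C, hC]; ring
      rw [this]
      gcongr
    have e2 : 0 ≤ (a * c) ^ 2 * (1 - β ^ 2) + (b * c) ^ 2 * (1 - α ^ 2) +
      (a * b * c) ^ 2 * (1 + 2 * (α * β * γ)) +
      2 * (a * b * c) * (c * A * B * (γ + α * β) + b * A * C * (β + α * γ) +
      a * B * C * (α + β * γ)) := by positivity
    unfold hyperbolicGram
    linarith
  have hD2 : a * c ≤ √(hyperbolicGram α β γ A B C a b c) := by
    apply Real.le_sqrt_of_sq_le
    have e1 : (a * c) ^ 2 * (1 - α ^ 2) ≤ (b * c) ^ 2 * (1 - α ^ 2) := by gcongr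
    have e2 : (a * c) ^ 2 * (α * β) ≤ a * b * c * (c * A * B * (α * β)) := by
      calc (a * c) ^ 2 * (α * β) = a * a * c * (c * 1 * 1 * (α * β)) := by ring
        _ ≤ _ := by gcongr
    have e3 : 0 ≤ (a * c) ^ 2 * (1 - (α - β) ^ 2) := by
      have : 0 ≤ 1 - (α - β) ^ 2 := by nlinarith
      positivity
    have e4 : 0 ≤ (a * b) ^ 2 * (1 - γ ^ 2) + 2 * (a * b * c) ^ 2 * (1 + α * β * γ) +
        2 * (a * b * c) * (c * A * B * γ + b * A * C * (β + α * γ) +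
      a * B * C * (α + β * γ)) := by positivity
    unfold hyperbolicGram
    linarith
  have hD3 : a * b * c ≤ √(hyperbolicGram α β γ A B C a b c) := by
    apply Real.le_sqrt_of_sq_le
    have e4 : 0 ≤ (a * b) ^ 2 * (1 - γ ^ 2) + (a * c) ^ 2 * (1 - β ^ 2) +
        (b * c) ^ 2 * (1 - α ^ 2) + (a * b * c) ^ 2 * (1 + 2 * (α * β * γ)) +
        2 * (a * b * c) * (c * A * B * (γ + α * β) + b * A * C * (β + α * γ) +
      a * B * C * (α + β * γ)) := by positivity
    unfold hyperbolicGram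
    linarith
  have hs := Real.sqrt_nonneg (hyperbolicGram α β γ A B C a b c)
  have hX : A * B - 1 ≤ coshSide γ A B a b - 1 := by
    unfold coshSide
    have : 0 ≤ γ * a * b := by positivity
    linarith
  refine le_trans ?_ (mul_le_mul_of_nonneg_right
    (mul_le_mul_of_nonneg_left hX (by norm_num)) hs)
  unfold hyperbolicWeight
  generalize √(hyperbolicGram α β γ A B C a b c) = s at *
  have f0 := sinh_mul_sinh_le hA hB hA1 hB1 ha hb
  have f1 : a * b * (a * b * C * (1 - γ ^ 2)) ≤ (A * B - 1) * s :=
    mul_le_mul f0 hD1 (by positivity) ((mul_pos ha hb).le.trans f0)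
  have hBA : a * B ≤ b * A := sinh_mul_cosh_le hA hB hA1 hB1 ha hab
  have f2 : a * B * (α + β * γ) + b * A * (β + α * γ) ≤ 4 * (b * A) := by
    have h5 : α + β * γ ≤ 2 := by nlinarith
    have h6 : β + α * γ ≤ 2 := by nlinarith
    have : a * B * (α + β * γ) ≤ b * A * 2 := by gcongr
    have : b * A * (β + α * γ) ≤ b * A * 2 := by gcongr
    linarith
  have hkey := sinh_mul_sinh_mul_sinh_le hA hB hA1 hB1 ha hb hc hs hD2 hD3 hab
  have f3 : a * b * c * (a * B * (α + β * γ) + b * A * (β + α * γ)) ≤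
      a * b * c * (4 * (b * A)) := by gcongr
  linarith

theorem hyperbolicWeight_le {α β γ A B C a b c : ℝ} (hα : α ∈ Icc (0 : ℝ) 1)
    (hβ : β ∈ Icc (0 : ℝ) 1) (hγ : γ ∈ Icc (0 : ℝ) 1) (hA : A ^ 2 = a ^ 2 + 1)
    (hB : B ^ 2 = b ^ 2 + 1) (hC : C ^ 2 = c ^ 2 + 1) (hA1 : 1 < A) (hB1 : 1 < B) (hC1 : 1 < C)
    (ha : 0 < a) (hb : 0 < b) (hc : 0 < c) :
    a * b * hyperbolicWeight α β γ A B C a b c ≤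
      16 * (coshSide γ A B a b - 1) * √(hyperbolicGram α β γ A B C a b c) := by
  rcases le_total a b with h | h
  · exact hyperbolicWeight_le_of_le hα hβ hγ hA hB hC hA1 hB1 hC1 ha hb hc h
  · have := hyperbolicWeight_le_of_le hβ hα hγ hB hA hC hB1 hA1 hC1 hb ha hc h
    rw [hyperbolicGram_swap, hyperbolicWeight_swap, coshSide_swap] at this
    linarith

/-- A bound, uniform in the length of the side, for one side's part of the derivative of an angle. -/
theorem abs_hyperbolic_partial_le {w X s δ d e : ℝ} (hw : 0 ≤ w) (hX : 1 < X) (hs : 0 < s)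
    (hwx : w ≤ 16 * (X - 1) * s) (hd : |d| ≤ δ) (he : |e| ≤ δ) :
    |w / ((X ^ 2 - 1) * s) * (d - X * e)| ≤ 32 * δ := by
  have hX2 : 0 < X ^ 2 - 1 := by nlinarith
  have h0 : 0 ≤ w / ((X ^ 2 - 1) * s) := by positivity
  -- Of `X ^ 2 - 1 = (X - 1) * (X + 1)` the weight bound uses up `X - 1`; the remaining `X + 1`
  -- compensates the growth of `d - X * e` in `X`.
  have h1 : w / ((X ^ 2 - 1) * s) ≤ 16 / (X + 1) := by
    rw [div_le_div_iff₀ (by positivity) (by positivity)]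
    nlinarith
  have hδ : 0 ≤ δ := (abs_nonneg _).trans hd
  have h2 : |d - X * e| ≤ (X + 1) * δ := by
    refine (abs_sub _ _).trans ?_
    rw [abs_mul, abs_of_pos (by linarith : 0 < X)]
    nlinarith
  rw [abs_mul, abs_of_nonneg h0]
  calc _ ≤ 16 / (X + 1) * ((X + 1) * δ) := by gcongr
    _ = 16 * δ := by field_simp
    _ ≤ _ := by linarith

theorem coshSide_radial_identity {α β γ A B C a b c : ℝ} (hA : A ^ 2 = a ^ 2 + 1)
    (hB : B ^ 2 = b ^ 2 + 1) :
    (a * B + γ * A * b) *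
        (coshSide β A C a c - coshSide γ A B a b * coshSide α B C b c) +
      b * hyperbolicWeight α β γ A B C a b c * coshSide γ A B a b =
    (β * c * B - γ * b * C) * (coshSide γ A B a b ^ 2 - 1) := by
  unfold coshSide hyperbolicWeight
  grind

theorem coshSide_lateral_identity {α β γ A B C a b c : ℝ} (hA : A ^ 2 = a ^ 2 + 1)
    (hB : B ^ 2 = b ^ 2 + 1) :
    (b * A + γ * a * B) *
        (coshSide β A C a c - coshSide γ A B a b * coshSide α B C b c) +
      (b * C + α * B * c) * (coshSide γ A B a b ^ 2 - 1) =
    a * hyperbolicWeight α β γ A B C a b c := by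
  unfold coshSide hyperbolicWeight
  grind

/-- The left side is the derivative of the law of cosines with denominators cleared. The lateral
identities give the coefficients of `db` and `dc`. For `da` the two radial identities leave
remainders proportional to `β * c * B - γ * b * C` and its negative, which cancel. -/
theorem coshSide_deriv_identity {α β γ A B C a b c da db dc : ℝ} (hA : A ^ 2 = a ^ 2 + 1)
    (hB : B ^ 2 = b ^ 2 + 1) (hC : C ^ 2 = c ^ 2 + 1) {x y X Y Z : ℝ}
    (hX : X = coshSide γ A B a b) (hY : Y = coshSide β A C a c) (hZ : Z = coshSide α B C b c)
    (hx : x = X ^ 2 - 1) (hy : y = Y ^ 2 - 1) :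
    (a * (a * B + γ * A * b) * da + b * (b * A + γ * a * B) * db) * (Y - X * Z) * y +
      (a * (a * C + β * A * c) * da + c * (c * A + β * a * C) * dc) * (X - Y * Z) * x +
      (b * (b * C + α * B * c) * db + c * (c * B + α * C * b) * dc) * (x * y) =
    a * b * hyperbolicWeight α β γ A B C a b c * (db - X * da) * y +
      a * c * hyperbolicWeight α γ β A C B a c b * (dc - Y * da) * x := by
  have i1 := coshSide_radial_identity (α := α) (β := β) (γ := γ) (C := C) (c := c) hA hB
  have i2 := coshSide_lateral_identity (α := α) (β := β) (γ := γ) (C := C) (c := c) hA hB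
  have j1 := coshSide_radial_identity (α := α) (β := γ) (γ := β) (C := B) (c := b) hA hC
  have j2 := coshSide_lateral_identity (α := α) (β := γ) (γ := β) (C := B) (c := b) hA hC
  rw [coshSide_swap α B C b c] at j1 j2
  rw [← hX, ← hY, ← hZ, ← hx] at i1 i2
  rw [← hX, ← hY, ← hZ, ← hy] at j1 j2
  linear_combination b * db * y * i2 + c * dc * x * j2 + a * da * y * i1 + a * da * x * j1

/-- Here `da`, `db`, `dc` are the velocities of the coordinates `u`. Without scale invariance, `da`
appears multiplied by the hyperbolic cosines of the adjacent sides. -/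
theorem hasDerivWithinAt_hyperbolicAngle {α β γ t da db dc : ℝ} {a b c : ℝ → ℝ} {S : Set ℝ}
    (hα : α ∈ Icc (0 : ℝ) 1) (hβ : β ∈ Icc (0 : ℝ) 1) (hγ : γ ∈ Icc (0 : ℝ) 1)
    {A B C : ℝ → ℝ} (hA : A t ^ 2 = a t ^ 2 + 1) (hB : B t ^ 2 = b t ^ 2 + 1)
    (hC : C t ^ 2 = c t ^ 2 + 1) (hA1 : 1 < A t) (hB1 : 1 < B t) (hC1 : 1 < C t)
    (ha0 : 0 < a t) (hb0 : 0 < b t) (hc0 : 0 < c t)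
    (ha : HasDerivWithinAt a (A t * (a t * da)) S t)
    (hb : HasDerivWithinAt b (B t * (b t * db)) S t)
    (hc : HasDerivWithinAt c (C t * (c t * dc)) S t)
    (hA' : HasDerivWithinAt A (a t * (a t * da)) S t)
    (hB' : HasDerivWithinAt B (b t * (b t * db)) S t)
    (hC' : HasDerivWithinAt C (c t * (c t * dc)) S t) :
    HasDerivWithinAt
      (fun s => Real.arccos (hyperbolicNum α β γ (A s) (B s) (C s) (a s) (b s) (c s) /
        √(hyperbolicDen β γ (A s) (B s) (C s) (a s) (b s) (c s))))
      (a t * b t * hyperbolicWeight α β γ (A t) (B t) (C t) (a t) (b t) (c t) /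
          ((coshSide γ (A t) (B t) (a t) (b t) ^ 2 - 1) *
            √(hyperbolicGram α β γ (A t) (B t) (C t) (a t) (b t) (c t))) *
          (db - coshSide γ (A t) (B t) (a t) (b t) * da) +
        a t * c t * hyperbolicWeight α γ β (A t) (C t) (B t) (a t) (c t) (b t) /
          ((coshSide β (A t) (C t) (a t) (c t) ^ 2 - 1) *
            √(hyperbolicGram α β γ (A t) (B t) (C t) (a t) (b t) (c t))) *
          (dc - coshSide β (A t) (C t) (a t) (c t) * da)) S t := by
  have hD := hyperbolicGram_pos hα hβ hγ (zero_lt_one.trans hA1) (zero_lt_one.trans hB1)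
    (zero_lt_one.trans hC1) ha0 hb0 hc0
  have hX1 := one_lt_coshSide hγ.1 hA1 hB1 ha0 hb0
  have hY1 := one_lt_coshSide hβ.1 hA1 hC1 ha0 hc0
  have hpq := hyperbolicDen_sub (α := α) (β := β) (γ := γ) hA hB hC
  have hX : HasDerivWithinAt (fun s => coshSide γ (A s) (B s) (a s) (b s)) _ S t :=
    (hA'.mul hB').add ((ha.const_mul γ).mul hb)
  have hY : HasDerivWithinAt (fun s => coshSide β (A s) (C s) (a s) (c s)) _ S t :=
    (hA'.mul hC').add ((ha.const_mul β).mul hc)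
  have hZ : HasDerivWithinAt (fun s => coshSide α (B s) (C s) (b s) (c s)) _ S t :=
    (hB'.mul hC').add ((hb.const_mul α).mul hc)
  have hp : HasDerivWithinAt
      (fun s => hyperbolicNum α β γ (A s) (B s) (C s) (a s) (b s) (c s)) _ S t :=
    (hX.mul hY).sub hZ
  have hq : HasDerivWithinAt
      (fun s => hyperbolicDen β γ (A s) (B s) (C s) (a s) (b s) (c s)) _ S t :=
    ((hX.pow 2).sub_const 1).mul ((hY.pow 2).sub_const 1)
  have h := hasDerivWithinAt_arccos_div_sqrt hp hq (by linarith)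
  refine h.congr_deriv ?_
  rw [hpq]
  have hs : 0 < √(hyperbolicGram α β γ (A t) (B t) (C t) (a t) (b t) (c t)) :=
    Real.sqrt_pos.2 hD
  simp only [Pi.pow_apply, hyperbolicDen, hyperbolicNum]
  generalize a t = a at *
  generalize b t = b at *
  generalize c t = c at *
  generalize A t = A at *
  generalize B t = B at *
  generalize C t = C at *
  generalize √(hyperbolicGram α β γ A B C a b c) = s at *
  have key := @coshSide_deriv_identity α β γ A B C a b c da db dc hA hB hC _ _ _ _ _
    rfl rfl rfl rfl rfl
  have hx : 0 < coshSide γ A B a b ^ 2 - 1 := by nlinarith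
  have hy : 0 < coshSide β A C a c ^ 2 - 1 := by nlinarith
  generalize coshSide γ A B a b = X at *
  generalize coshSide β A C a c = Y at *
  generalize coshSide α B C b c = Z at *
  obtain ⟨x, hxe⟩ : ∃ x, x = X ^ 2 - 1 := ⟨_, rfl⟩
  obtain ⟨y, hye⟩ : ∃ y, y = Y ^ 2 - 1 := ⟨_, rfl⟩
  rw [← hxe] at hx key ⊢
  rw [← hye] at hy key ⊢
  field_simp
  push_cast
  have hX2 : X ^ 2 = x + 1 := by linarith
  have hY2 : Y ^ 2 = y + 1 := by linarith
  linear_combination 2 * key +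
    2 * (a ^ 2 * da * B + A * b ^ 2 * db + a * b * γ * (da * A + B * db)) * y * Y * hX2 +
    2 * (a ^ 2 * da * C + A * c ^ 2 * dc + a * c * β * (da * A + C * dc)) * x * X * hY2

theorem innerAngle_hyperbolic {a b c φ χ ψ : ℝ} (ha : 0 < a) (hb : 0 < b) (hc : 0 < c)
    (hφ : 0 ≤ Real.cos φ) (hχ : 0 ≤ Real.cos χ) (hψ : 0 ≤ Real.cos ψ) :
    innerAngle .hyperbolic (edgeLength .hyperbolic a b φ) (edgeLength .hyperbolic a c χ)
      (edgeLength .hyperbolic b c ψ) =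
    Real.arccos (hyperbolicNum (Real.cos ψ) (Real.cos χ) (Real.cos φ) (Real.cosh a)
        (Real.cosh b) (Real.cosh c) (Real.sinh a) (Real.sinh b) (Real.sinh c) /
      √(hyperbolicDen (Real.cos χ) (Real.cos φ) (Real.cosh a)
        (Real.cosh b) (Real.cosh c) (Real.sinh a) (Real.sinh b) (Real.sinh c))) := by
  have hside : ∀ {x y χ : ℝ}, 0 < x → 0 < y → 0 ≤ Real.cos χ →
      1 < coshSide (Real.cos χ) (Real.cosh x) (Real.cosh y) (Real.sinh x) (Real.sinh y) :=
    fun hx hy hχ => one_lt_coshSide hχ (Real.one_lt_cosh.2 hx.ne') (Real.one_lt_cosh.2 hy.ne')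
      (Real.sinh_pos_iff.2 hx) (Real.sinh_pos_iff.2 hy)
  have h1 := hside ha hb hφ
  have h2 := hside ha hc hχ
  have h3 := hside hb hc hψ
  simp only [innerAngle, edgeLength, hyperbolicNum, hyperbolicDen]
  unfold coshSide at *
  rw [Real.cosh_arcosh h1.le, Real.cosh_arcosh h2.le, Real.cosh_arcosh h3.le,
    Real.sinh_arcosh h1.le, Real.sinh_arcosh h2.le, ← Real.sqrt_mul (by nlinarith)]

/-- The angle at a vertex of large hyperbolic radius is small, uniformly in the other radii. -/
theorem one_sub_le_hyperbolicNum_div {α β γ A B C a b c : ℝ} (hα : α ∈ Icc (0 : ℝ) 1)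
    (hβ : β ∈ Icc (0 : ℝ) 1) (hγ : γ ∈ Icc (0 : ℝ) 1) (hB : B ^ 2 = b ^ 2 + 1)
    (hC : C ^ 2 = c ^ 2 + 1) (hA1 : 1 < A) (hB1 : 1 < B) (hC1 : 1 < C)
    (ha : 0 < a) (hb : 0 < b) (hc : 0 < c) (hA2 : 2 ≤ A ^ 2) :
    1 - 2 / A ^ 2 ≤
      hyperbolicNum α β γ A B C a b c / √(hyperbolicDen β γ A B C a b c) := by
  have hX1 := one_lt_coshSide hγ.1 hA1 hB1 ha hb
  have hY1 := one_lt_coshSide hβ.1 hA1 hC1 ha hc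
  have hX : A * B ≤ coshSide γ A B a b := by
    have := mul_nonneg (mul_nonneg hγ.1 ha.le) hb.le
    unfold coshSide; linarith
  have hY : A * C ≤ coshSide β A C a c := by
    have := mul_nonneg (mul_nonneg hβ.1 ha.le) hc.le
    unfold coshSide; linarith
  have hZ : coshSide α B C b c ≤ 2 * (B * C) := by
    have h1 : b * c ≤ B * C := mul_le_mul (by nlinarith) (by nlinarith) hc.le (by linarith)
    have h2 : α * (b * c) ≤ 1 * (b * c) := by gcongr; exact hα.2
    unfold coshSide; linarith
  -- The factors `B` and `C` cancel in the quotient of the bounds, which makes the estimate uniform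
  -- in the other two radii.
  have hZ2 : A ^ 2 * coshSide α B C b c ≤
      2 * (coshSide γ A B a b * coshSide β A C a c) := by
    have h1 : A * B * (A * C) ≤ coshSide γ A B a b * coshSide β A C a c := by gcongr
    have h2 : A ^ 2 * coshSide α B C b c ≤ A ^ 2 * (2 * (B * C)) := by gcongr
    linarith
  unfold hyperbolicNum hyperbolicDen
  generalize coshSide γ A B a b = X at *
  generalize coshSide β A C a c = Y at *
  generalize coshSide α B C b c = Z at *
  have hX0 : 0 < X ^ 2 - 1 := by nlinarith
  have hY0 : 0 < Y ^ 2 - 1 := by nlinarith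
  have hs0 : 0 < √((X ^ 2 - 1) * (Y ^ 2 - 1)) := Real.sqrt_pos.2 (mul_pos hX0 hY0)
  have hXY : 0 < X * Y := mul_pos (by linarith) (by linarith)
  have hs : √((X ^ 2 - 1) * (Y ^ 2 - 1)) ≤ X * Y := by
    rw [Real.sqrt_le_left hXY.le]
    nlinarith
  have hA0 : 0 < A ^ 2 := by positivity
  have hle : 0 ≤ 1 - 2 / A ^ 2 := by
    rw [sub_nonneg, div_le_one hA0]; exact hA2
  rw [le_div_iff₀ hs0]
  calc (1 - 2 / A ^ 2) * √((X ^ 2 - 1) * (Y ^ 2 - 1)) ≤ (1 - 2 / A ^ 2) * (X * Y) := by gcongr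
    _ ≤ X * Y - Z := by
      have : Z ≤ 2 / A ^ 2 * (X * Y) := by
        rw [div_mul_eq_mul_div, le_div_iff₀ hA0]; linarith
      linarith

end HyperbolicAngle

/-! ### The coordinate that turns the flow into `u' = -K` -/

section Coordinate

/-- The factor of the curvature in the flow: `r' = -K * speed r`. -/
def speed (g : Background) (r : ℝ) : ℝ :=
  match g with
  | .euclidean => r
  | .hyperbolic => Real.sinh r

/-- The coordinate `u` in which the flow reads `u' = -K`. -/
def coord (g : Background) (r : ℝ) : ℝ :=
  match g with
  | .euclidean => Real.log r
  | .hyperbolic => -Real.arsinh (1 / Real.sinh r)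

/-- The inverse of `coord`. -/
def radius (g : Background) (u : ℝ) : ℝ :=
  match g with
  | .euclidean => Real.exp u
  | .hyperbolic => Real.arsinh (1 / Real.sinh (-u))

/-- The range of `coord`. -/
def coordRange (g : Background) : Set ℝ :=
  match g with
  | .euclidean => univ
  | .hyperbolic => Iio 0

theorem convex_coordRange (g : Background) : Convex ℝ (coordRange g) := by
  cases g
  exacts [convex_univ, convex_Iio 0]

theorem speed_pos (g : Background) {r : ℝ} (hr : 0 < r) : 0 < speed g r := by
  cases g
  exacts [hr, Real.sinh_pos_iff.2 hr]

theorem radius_pos {g : Background} {u : ℝ} (hu : u ∈ coordRange g) : 0 < radius g u := by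
  cases g with
  | euclidean => exact Real.exp_pos u
  | hyperbolic =>
    have : 0 < Real.sinh (-u) := Real.sinh_pos_iff.2 (neg_pos.2 hu)
    exact Real.arsinh_pos_iff.2 (by positivity)

theorem coord_mem (g : Background) {r : ℝ} (hr : 0 < r) : coord g r ∈ coordRange g := by
  cases g with
  | euclidean => exact mem_univ _
  | hyperbolic =>
    have : 0 < Real.sinh r := Real.sinh_pos_iff.2 hr
    exact neg_lt_zero.2 (Real.arsinh_pos_iff.2 (by positivity))

theorem radius_coord (g : Background) {r : ℝ} (hr : 0 < r) : radius g (coord g r) = r := by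
  cases g with
  | euclidean => exact Real.exp_log hr
  | hyperbolic => simp [radius, coord]

/-- This function is an involution of `(0, ∞)`; up to signs it is both the hyperbolic `coord` and
its inverse, so one derivative serves for both. -/
theorem hasDerivAt_arsinh_inv_sinh {x : ℝ} (hx : 0 < x) :
    HasDerivAt (fun y => Real.arsinh (1 / Real.sinh y)) (-(1 / Real.sinh x)) x := by
  have hs : 0 < Real.sinh x := Real.sinh_pos_iff.2 hx
  have h1 : HasDerivAt (fun y => 1 / Real.sinh y) _ x :=
    (hasDerivAt_const x (1 : ℝ)).div (Real.hasDerivAt_sinh x) hs.ne'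
  refine h1.arsinh.congr_deriv ?_
  have hc := Real.cosh_pos x
  have h2 : √(1 + (1 / Real.sinh x) ^ 2) = Real.cosh x / Real.sinh x := by
    rw [Real.sqrt_eq_iff_mul_self_eq (by positivity) (by positivity)]
    have := Real.cosh_sq x
    field_simp
    linarith
  rw [h2, smul_eq_mul]
  field_simp
  ring

theorem hasDerivAt_coord (g : Background) {r : ℝ} (hr : 0 < r) :
    HasDerivAt (coord g) (1 / speed g r) r := by
  cases g with
  | euclidean => simpa [coord, speed] using! Real.hasDerivAt_log hr.ne'
  | hyperbolic =>
    exact (hasDerivAt_arsinh_inv_sinh hr).neg.congr_deriv (by simp [speed])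

theorem hasDerivAt_radius {g : Background} {u : ℝ} (hu : u ∈ coordRange g) :
    HasDerivAt (radius g) (speed g (radius g u)) u := by
  cases g with
  | euclidean => exact Real.hasDerivAt_exp u
  | hyperbolic =>
    refine ((hasDerivAt_arsinh_inv_sinh (neg_pos.2 hu)).comp u (hasDerivAt_neg u)).congr_deriv ?_
    simp [speed, radius]

end Coordinate

/-! ### Uniform estimates for the angles of one face -/

section Face

variable {φ χ ψ : ℝ}

theorem cos_mem_Icc (hφ : φ ∈ Icc 0 (Real.pi / 2)) : Real.cos φ ∈ Icc (0 : ℝ) 1 :=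
  ⟨Real.cos_nonneg_of_neg_pi_div_two_le_of_le (by linarith [hφ.1, Real.pi_pos]) hφ.2,
    Real.cos_le_one φ⟩

/-- The angle of a face at the vertex of radius `a`, where the circles of radii `a`, `b`
(`a`, `c`; `b`, `c`) meet at the angle `φ` (`χ`; `ψ`). -/
def faceAngle (g : Background) (φ χ ψ a b c : ℝ) : ℝ :=
  innerAngle g (edgeLength g a b φ) (edgeLength g a c χ) (edgeLength g b c ψ)

theorem faceAngle_mem_Icc (g : Background) (φ χ ψ a b c : ℝ) :
    faceAngle g φ χ ψ a b c ∈ Icc 0 Real.pi := by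
  cases g <;> exact ⟨Real.arccos_nonneg _, Real.arccos_le_pi _⟩

/-- Each adjacent side contributes at most `32 * δ`; in the Euclidean case this is the weight bound
`16` times `|db - da| ≤ 2 * δ`. -/
theorem exists_hasDerivWithinAt_faceAngle (g : Background) (hφ : φ ∈ Icc 0 (Real.pi / 2))
    (hχ : χ ∈ Icc 0 (Real.pi / 2)) (hψ : ψ ∈ Icc 0 (Real.pi / 2)) {a b c : ℝ → ℝ} {S : Set ℝ}
    (ha0 : ∀ s ∈ S, 0 < a s) (hb0 : ∀ s ∈ S, 0 < b s) (hc0 : ∀ s ∈ S, 0 < c s) {t : ℝ}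
    (ht : t ∈ S) {da db dc δ : ℝ} (hda : |da| ≤ δ) (hdb : |db| ≤ δ) (hdc : |dc| ≤ δ)
    (ha : HasDerivWithinAt a (speed g (a t) * da) S t)
    (hb : HasDerivWithinAt b (speed g (b t) * db) S t)
    (hc : HasDerivWithinAt c (speed g (c t) * dc) S t) :
    ∃ d, |d| ≤ 64 * δ ∧
      HasDerivWithinAt (fun s => faceAngle g φ χ ψ (a s) (b s) (c s)) d S t := by
  have h1 := cos_mem_Icc hφ
  have h2 := cos_mem_Icc hχ
  have h3 := cos_mem_Icc hψ
  cases g with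
  | euclidean =>
    have hD := hasDerivWithinAt_euclideanAngle h3 h2 h1 (ha0 t ht) (hb0 t ht) (hc0 t ht) ha hb hc
    refine ⟨_, ?_, hD.congr
      (fun s hs => innerAngle_euclidean (ha0 s hs) (hb0 s hs) (hc0 s hs) h1.1 h2.1 h3.1)
      (innerAngle_euclidean (ha0 t ht) (hb0 t ht) (hc0 t ht) h1.1 h2.1 h3.1)⟩
    replace ha0 := ha0 t ht
    replace hb0 := hb0 t ht
    replace hc0 := hc0 t ht
    have hγ0 := h1.1
    have hβ0 := h2.1
    have hs := Real.sqrt_pos.2 (euclideanGram_pos h3 h2 h1 ha0 hb0 hc0)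
    have e1 : |db - da| ≤ 2 * δ := (abs_sub _ _).trans (by linarith)
    have e2 : |dc - da| ≤ 2 * δ := (abs_sub _ _).trans (by linarith)
    have b1 := abs_div_le_of_weight (mul_nonneg (mul_pos ha0 hb0).le
      (euclideanWeight_nonneg h3 h2 h1 ha0 hb0 hc0)) (by positivity) hs
      (euclideanWeight_le h3 h2 h1 ha0 hb0 hc0) e1
    have w := euclideanWeight_le h3 h1 h2 ha0 hc0 hb0
    rw [euclideanGram_swap'] at w
    have b2 := abs_div_le_of_weight (mul_nonneg (mul_pos ha0 hc0).le
      (euclideanWeight_nonneg h3 h1 h2 ha0 hc0 hb0)) (by positivity) hs w e2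
    exact (abs_add_le _ _).trans (by linarith)
  | hyperbolic =>
    have hsq : ∀ x : ℝ, Real.cosh x ^ 2 = Real.sinh x ^ 2 + 1 := Real.cosh_sq
    have hS : ∀ {f : ℝ → ℝ} {d : ℝ}, HasDerivWithinAt f (Real.sinh (f t) * d) S t →
        HasDerivWithinAt (fun s => Real.sinh (f s))
          (Real.cosh (f t) * (Real.sinh (f t) * d)) S t := fun hf => hf.sinh
    have hC : ∀ {f : ℝ → ℝ} {d : ℝ}, HasDerivWithinAt f (Real.sinh (f t) * d) S t →
        HasDerivWithinAt (fun s => Real.cosh (f s))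
          (Real.sinh (f t) * (Real.sinh (f t) * d)) S t := fun hf => hf.cosh
    have hA1 := Real.one_lt_cosh.2 (ha0 t ht).ne'
    have hB1 := Real.one_lt_cosh.2 (hb0 t ht).ne'
    have hC1 := Real.one_lt_cosh.2 (hc0 t ht).ne'
    have sa := Real.sinh_pos_iff.2 (ha0 t ht)
    have sb := Real.sinh_pos_iff.2 (hb0 t ht)
    have sc := Real.sinh_pos_iff.2 (hc0 t ht)
    have hD := hasDerivWithinAt_hyperbolicAngle (A := fun s => Real.cosh (a s))
      (B := fun s => Real.cosh (b s)) (C := fun s => Real.cosh (c s)) h3 h2 h1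
      (hsq _) (hsq _) (hsq _) hA1 hB1 hC1 sa sb sc (hS ha) (hS hb) (hS hc) (hC ha) (hC hb) (hC hc)
    refine ⟨_, ?_, hD.congr
      (fun s hs => innerAngle_hyperbolic (ha0 s hs) (hb0 s hs) (hc0 s hs) h1.1 h2.1 h3.1)
      (innerAngle_hyperbolic (ha0 t ht) (hb0 t ht) (hc0 t ht) h1.1 h2.1 h3.1)⟩
    have hA0 := zero_lt_one.trans hA1
    have hB0 := zero_lt_one.trans hB1
    have hC0 := zero_lt_one.trans hC1
    have hs := Real.sqrt_pos.2 (hyperbolicGram_pos h3 h2 h1 hA0 hB0 hC0 sa sb sc)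
    have b1 := abs_hyperbolic_partial_le (mul_nonneg (mul_pos sa sb).le
      (hyperbolicWeight_nonneg h3 h2 h1 hA0 hB0 hC0 sa sb sc))
      (one_lt_coshSide h1.1 hA1 hB1 sa sb) hs
      (hyperbolicWeight_le h3 h2 h1 (hsq _) (hsq _) (hsq _) hA1 hB1 hC1 sa sb sc) hdb hda
    have w := hyperbolicWeight_le h3 h1 h2 (hsq _) (hsq _) (hsq _) hA1 hC1 hB1 sa sc sb
    rw [hyperbolicGram_swap'] at w
    have b2 := abs_hyperbolic_partial_le (mul_nonneg (mul_pos sa sc).le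
      (hyperbolicWeight_nonneg h3 h1 h2 hA0 hC0 hB0 sa sc sb))
      (one_lt_coshSide h2.1 hA1 hC1 sa sc) hs w hdc hda
    exact (abs_add_le _ _).trans (by linarith)

/-- The angles of a face are Lipschitz functions of the coordinates of its radii, with a constant
that does not depend on the intersection angles. -/
theorem abs_faceAngle_sub_le (g : Background) (hφ : φ ∈ Icc 0 (Real.pi / 2))
    (hχ : χ ∈ Icc 0 (Real.pi / 2)) (hψ : ψ ∈ Icc 0 (Real.pi / 2)) {a b c a' b' c' δ : ℝ}
    (ha : a ∈ coordRange g) (hb : b ∈ coordRange g) (hc : c ∈ coordRange g)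
    (ha' : a' ∈ coordRange g) (hb' : b' ∈ coordRange g) (hc' : c' ∈ coordRange g)
    (hda : |a - a'| ≤ δ) (hdb : |b - b'| ≤ δ) (hdc : |c - c'| ≤ δ) :
    |faceAngle g φ χ ψ (radius g a) (radius g b) (radius g c) -
      faceAngle g φ χ ψ (radius g a') (radius g b') (radius g c')| ≤ 64 * δ := by
  -- Mean value inequality along the segment between the two points in `u`-coordinates, which stays
  -- in the convex range and has constant velocity.
  have hmem : ∀ {x y : ℝ}, x ∈ coordRange g → y ∈ coordRange g → ∀ s ∈ Icc (0 : ℝ) 1,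
      y + s * (x - y) ∈ coordRange g := fun {x y} hx hy s hs =>
    (convex_coordRange g).add_smul_sub_mem hy hx hs
  have hder : ∀ {x y : ℝ}, x ∈ coordRange g → y ∈ coordRange g → ∀ s ∈ Icc (0 : ℝ) 1,
      HasDerivWithinAt (fun s => radius g (y + s * (x - y)))
        (speed g (radius g (y + s * (x - y))) * (x - y)) (Icc 0 1) s := by
    intro x y hx hy s hs
    have h := ((hasDerivAt_id s).mul_const (x - y)).const_add y
    rw [one_mul] at h
    exact ((hasDerivAt_radius (hmem hx hy s hs)).comp s h).hasDerivWithinAt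
  have hall : ∀ s ∈ Icc (0 : ℝ) 1, ∃ d, |d| ≤ 64 * δ ∧
      HasDerivWithinAt (fun s => faceAngle g φ χ ψ (radius g (a' + s * (a - a')))
        (radius g (b' + s * (b - b'))) (radius g (c' + s * (c - c')))) d (Icc 0 1) s :=
    fun s hs => exists_hasDerivWithinAt_faceAngle g hφ hχ hψ
      (fun s hs => radius_pos (hmem ha ha' s hs)) (fun s hs => radius_pos (hmem hb hb' s hs))
      (fun s hs => radius_pos (hmem hc hc' s hs)) hs hda hdb hdc (hder ha ha' s hs)
      (hder hb hb' s hs) (hder hc hc' s hs)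
  choose! d hd1 hd2 using hall
  have h := norm_image_sub_le_of_norm_deriv_le_segment_01' hd2
    (fun s hs => hd1 s (Ico_subset_Icc_self hs))
  simpa using h

theorem contDiffOn_faceAngle (g : Background) (hφ : φ ∈ Icc 0 (Real.pi / 2))
    (hχ : χ ∈ Icc 0 (Real.pi / 2)) (hψ : ψ ∈ Icc 0 (Real.pi / 2)) {a b c : ℝ → ℝ} {S : Set ℝ}
    (ha0 : ∀ s ∈ S, 0 < a s) (hb0 : ∀ s ∈ S, 0 < b s) (hc0 : ∀ s ∈ S, 0 < c s)
    {n : WithTop ℕ∞} (ha : ContDiffOn ℝ n a S) (hb : ContDiffOn ℝ n b S)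
    (hc : ContDiffOn ℝ n c S) :
    ContDiffOn ℝ n (fun s => faceAngle g φ χ ψ (a s) (b s) (c s)) S := by
  have h1 := cos_mem_Icc hφ
  have h2 := cos_mem_Icc hχ
  have h3 := cos_mem_Icc hψ
  cases g with
  | euclidean =>
    refine ContDiffOn.congr (contDiffOn_arccos_div_sqrt ?_ ?_ fun s hs => ?_)
      (fun s hs => innerAngle_euclidean (ha0 s hs) (hb0 s hs) (hc0 s hs) h1.1 h2.1 h3.1)
    · unfold euclideanNum; fun_prop
    · unfold euclideanDen; fun_prop
    · rw [← sub_pos, euclideanDen_sub]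
      exact euclideanGram_pos h3 h2 h1 (ha0 s hs) (hb0 s hs) (hc0 s hs)
  | hyperbolic =>
    have ha1 := ha.sinh
    have hb1 := hb.sinh
    have hc1 := hc.sinh
    have ha2 := ha.cosh
    have hb2 := hb.cosh
    have hc2 := hc.cosh
    refine ContDiffOn.congr (contDiffOn_arccos_div_sqrt ?_ ?_ fun s hs => ?_)
      (fun s hs => innerAngle_hyperbolic (ha0 s hs) (hb0 s hs) (hc0 s hs) h1.1 h2.1 h3.1)
    · unfold hyperbolicNum coshSide; fun_prop
    · unfold hyperbolicDen coshSide; fun_prop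
    · rw [← sub_pos, hyperbolicDen_sub (Real.cosh_sq _) (Real.cosh_sq _) (Real.cosh_sq _)]
      exact hyperbolicGram_pos h3 h2 h1 (Real.cosh_pos _) (Real.cosh_pos _) (Real.cosh_pos _)
        (Real.sinh_pos_iff.2 (ha0 s hs)) (Real.sinh_pos_iff.2 (hb0 s hs))
        (Real.sinh_pos_iff.2 (hc0 s hs))

theorem tendsto_cosh_atTop : Filter.Tendsto Real.cosh Filter.atTop Filter.atTop := by
  refine Filter.tendsto_atTop_mono (fun a => ?_) Filter.tendsto_id
  rcases le_total 0 a with h | h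
  · exact (Real.self_le_sinh_iff.2 h).trans (Real.sinh_lt_cosh a).le
  · exact h.trans (Real.cosh_pos a).le

/-- The hyperbolic angle at a vertex of large radius is small. -/
theorem exists_faceAngle_hyperbolic_le {ε : ℝ} (hε : 0 < ε) :
    ∃ R : ℝ, ∀ φ ∈ Icc 0 (Real.pi / 2), ∀ χ ∈ Icc 0 (Real.pi / 2), ∀ ψ ∈ Icc 0 (Real.pi / 2),
      ∀ a b c : ℝ, 0 < a → 0 < b → 0 < c → R ≤ a →
        faceAngle .hyperbolic φ χ ψ a b c ≤ ε := by
  have hlim : Filter.Tendsto (fun a : ℝ => Real.arccos (1 - 2 / Real.cosh a ^ 2))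
      Filter.atTop (nhds (Real.arccos (1 - 0))) := by
    refine (Real.continuous_arccos.tendsto _).comp (tendsto_const_nhds.sub ?_)
    exact tendsto_const_nhds.div_atTop
      ((Filter.tendsto_pow_atTop two_ne_zero).comp tendsto_cosh_atTop)
  rw [sub_zero, Real.arccos_one] at hlim
  have hcosh : ∀ᶠ a : ℝ in Filter.atTop, 2 ≤ Real.cosh a ^ 2 :=
    ((Filter.tendsto_pow_atTop two_ne_zero).comp tendsto_cosh_atTop).eventually_ge_atTop 2
  obtain ⟨R, hR⟩ := Filter.eventually_atTop.1 ((hlim.eventually_lt_const hε).and hcosh)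
  refine ⟨R, fun φ hφ χ hχ ψ hψ a b c ha hb hc hRa => ?_⟩
  have h1 := cos_mem_Icc hφ
  have h2 := cos_mem_Icc hχ
  have h3 := cos_mem_Icc hψ
  rw [faceAngle, innerAngle_hyperbolic ha hb hc h1.1 h2.1 h3.1]
  refine (Real.arccos_le_arccos ?_).trans (hR a hRa).1.le
  exact one_sub_le_hyperbolicNum_div h3 h2 h1 (Real.cosh_sq _) (Real.cosh_sq _)
    (Real.one_lt_cosh.2 ha.ne') (Real.one_lt_cosh.2 hb.ne') (Real.one_lt_cosh.2 hc.ne')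
    (Real.sinh_pos_iff.2 ha) (Real.sinh_pos_iff.2 hb) (Real.sinh_pos_iff.2 hc) (hR a hRa).2

end Face

/-! ### Curvature as a bounded Lipschitz field -/

section Curvature

variable {V : Type*} {T : AbstractSimplicialComplex V} {Φ : Sym2 V → ℝ}

/-- The angle at `i` of a face is a function of three radii, with admissible intersection
angles. -/
theorem exists_theta_eq (hΦ : ∀ e ∈ (skeleton T).edgeSet, Φ e ∈ Icc 0 (Real.pi / 2)) {i : V}
    {e : Sym2 V} (he : e ∈ oppositeEdges T i) :
    ∃ j k, ∃ φ ∈ Icc 0 (Real.pi / 2), ∃ χ ∈ Icc 0 (Real.pi / 2), ∃ ψ ∈ Icc 0 (Real.pi / 2),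
      ∀ g r, theta g Φ r i e = faceAngle g φ χ ψ (r i) (r j) (r k) := by
  classical
  obtain ⟨j, k, rfl, hij, hik, hjk, hface⟩ := he
  have hedge : ∀ x y, x ≠ y → ({x, y} : Finset V) ⊆ {i, j, k} →
      Φ s(x, y) ∈ Icc 0 (Real.pi / 2) := fun x y hxy hsub => by
    refine hΦ _ ⟨hxy, ?_⟩
    have : ({x, y} : Finset V) ∈ T.faces :=
      (T.isRelLowerSet_faces hface).2 hsub (Finset.insert_nonempty _ _)
    convert this
  refine ⟨j, k, _, hedge i j hij ?_, _, hedge i k hik ?_, _, hedge j k hjk ?_, fun g r => rfl⟩ <;>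
  · intro x
    simp only [Finset.mem_insert, Finset.mem_singleton]
    tauto

/-- The other two vertices of a face at `i` are neighbours of `i`, so `N * N` bounds the number of
faces at `i`. -/
theorem exists_ncard_oppositeEdges_le (hdeg : ∃ N : ℕ, ∀ i, degree T i ≤ N) :
    ∃ M : ℕ, ∀ i, (oppositeEdges T i).Finite ∧ (oppositeEdges T i).ncard ≤ M := by
  classical
  obtain ⟨N, hN⟩ := hdeg
  refine ⟨N * N, fun i => ?_⟩
  have hfin : ((skeleton T).neighborSet i).Finite := finite_of_encard_le_coe (hN i)
  have hcard : ((skeleton T).neighborSet i).ncard ≤ N := by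
    have h := hN i
    rw [degree, ← hfin.cast_ncard_eq] at h
    exact_mod_cast h
  have hsub : oppositeEdges T i ⊆ (fun p : V × V => s(p.1, p.2)) ''
      ((skeleton T).neighborSet i ×ˢ (skeleton T).neighborSet i) := by
    rintro e ⟨j, k, rfl, hij, hik, hjk, hface⟩
    have hedge : ∀ y, i ≠ y → ({i, y} : Finset V) ⊆ {i, j, k} →
        y ∈ (skeleton T).neighborSet i := fun y hy hs => by
      refine ⟨hy, ?_⟩
      have : ({i, y} : Finset V) ∈ T.faces :=
        (T.isRelLowerSet_faces hface).2 hs (Finset.insert_nonempty _ _)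
      convert this
    refine ⟨(j, k), ⟨hedge j hij ?_, hedge k hik ?_⟩, rfl⟩ <;>
    · intro x
      simp only [Finset.mem_insert, Finset.mem_singleton]
      tauto
  have hfin2 := (hfin.prod hfin).image (fun p : V × V => s(p.1, p.2))
  refine ⟨hfin2.subset hsub, (ncard_le_ncard hsub hfin2).trans
    ((ncard_image_le (hfin.prod hfin)).trans ?_)⟩
  rw [ncard_prod]
  exact Nat.mul_le_mul hcard hcard

theorem curvature_eq_sum {i : V} (hfin : (oppositeEdges T i).Finite) (g : Background)
    (r : V → ℝ) :
    curvature g T Φ r i = 2 * Real.pi - ∑ e ∈ hfin.toFinset, theta g Φ r i e := by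
  rw [curvature, finsum_mem_eq_finite_toFinset_sum _ hfin]

/-- The flow field in the coordinates `coord g (r i)`. -/
def coordField (g : Background) (T : AbstractSimplicialComplex V) (Φ : Sym2 V → ℝ) (u : V → ℝ)
    (i : V) : ℝ :=
  -curvature g T Φ (fun j => radius g (u j)) i

/-- At most `M` angles enter, each in `[0, π]` and each Lipschitz with constant `64`. -/
theorem isUniformField_coordField (g : Background)
    (hΦ : ∀ e ∈ (skeleton T).edgeSet, Φ e ∈ Icc 0 (Real.pi / 2)) {M : ℕ}
    (hM : ∀ i, (oppositeEdges T i).Finite ∧ (oppositeEdges T i).ncard ≤ M) :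
    IsUniformField (coordField g T Φ) {u | ∀ i, u i ∈ coordRange g}
      (2 * Real.pi + M * Real.pi) (64 * M) where
  bound u _ i := by
    have hcard : ((hM i).1.toFinset.card : ℝ) ≤ M := by
      rw [← ncard_eq_toFinset_card _ (hM i).1]; exact_mod_cast (hM i).2
    have hθ : ∀ e ∈ (hM i).1.toFinset,
        theta g Φ (fun j => radius g (u j)) i e ∈ Icc 0 Real.pi := fun e he => by
      obtain ⟨j, k, φ, -, χ, -, ψ, -, h⟩ := exists_theta_eq hΦ ((hM i).1.mem_toFinset.1 he)
      rw [h]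
      exact faceAngle_mem_Icc ..
    have h0 := Finset.sum_nonneg fun e he => (hθ e he).1
    have h1 := Finset.sum_le_card_nsmul _ _ _ fun e he => (hθ e he).2
    rw [nsmul_eq_mul] at h1
    have h2 : ((hM i).1.toFinset.card : ℝ) * Real.pi ≤ M * Real.pi := by gcongr
    have := Real.pi_pos
    rw [coordField, curvature_eq_sum (hM i).1, abs_le]
    constructor <;> linarith
  lipschitz u hu v hv δ huv i := by
    have hδ : 0 ≤ δ := (abs_nonneg _).trans (huv i)
    have hcard : ((hM i).1.toFinset.card : ℝ) ≤ M := by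
      rw [← ncard_eq_toFinset_card _ (hM i).1]; exact_mod_cast (hM i).2
    rw [coordField, coordField, curvature_eq_sum (hM i).1, curvature_eq_sum (hM i).1]
    rw [show ∀ x y z : ℝ, -(x - y) - -(x - z) = y - z by intros; ring,
      ← Finset.sum_sub_distrib]
    calc _ ≤ ∑ e ∈ (hM i).1.toFinset, |theta g Φ (fun j => radius g (u j)) i e -
          theta g Φ (fun j => radius g (v j)) i e| := Finset.abs_sum_le_sum_abs _ _
      _ ≤ (hM i).1.toFinset.card • (64 * δ) := by
        refine Finset.sum_le_card_nsmul _ _ _ fun e he => ?_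
        obtain ⟨j, k, φ, hφ, χ, hχ, ψ, hψ, h⟩ := exists_theta_eq hΦ ((hM i).1.mem_toFinset.1 he)
        rw [h, h]
        exact abs_faceAngle_sub_le g hφ hχ hψ (hu i) (hu j) (hu k) (hv i) (hv j) (hv k)
          (huv i) (huv j) (huv k)
      _ ≤ M * (64 * δ) := by rw [nsmul_eq_mul]; gcongr
      _ = _ := by ring

/-- The hyperbolic curvature at a vertex of large radius is positive. -/
theorem exists_curvature_hyperbolic_pos
    (hΦ : ∀ e ∈ (skeleton T).edgeSet, Φ e ∈ Icc 0 (Real.pi / 2)) {M : ℕ}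
    (hM : ∀ i, (oppositeEdges T i).Finite ∧ (oppositeEdges T i).ncard ≤ M) :
    ∃ R : ℝ, ∀ r : V → ℝ, (∀ j, 0 < r j) → ∀ i, R ≤ r i →
      0 < curvature .hyperbolic T Φ r i := by
  have hπ := Real.pi_pos
  -- With this `ε` at most `M` angles add up to at most `π < 2π`; the `+ 1` also covers `M = 0`.
  obtain ⟨R, hR⟩ := exists_faceAngle_hyperbolic_le (ε := Real.pi / (M + 1)) (by positivity)
  refine ⟨R, fun r hr i hi => ?_⟩
  have hcard : ((hM i).1.toFinset.card : ℝ) ≤ M := by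
    rw [← ncard_eq_toFinset_card _ (hM i).1]; exact_mod_cast (hM i).2
  have h1 : ∑ e ∈ (hM i).1.toFinset, theta .hyperbolic Φ r i e ≤
      (hM i).1.toFinset.card • (Real.pi / (M + 1)) := by
    refine Finset.sum_le_card_nsmul _ _ _ fun e he => ?_
    obtain ⟨j, k, φ, hφ, χ, hχ, ψ, hψ, h⟩ := exists_theta_eq hΦ ((hM i).1.mem_toFinset.1 he)
    rw [h]
    exact hR φ hφ χ hχ ψ hψ _ _ _ (hr i) (hr j) (hr k) hi
  have h2 : (hM i).1.toFinset.card • (Real.pi / (M + 1)) ≤ Real.pi := by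
    rw [nsmul_eq_mul, mul_div_assoc', div_le_iff₀ (by positivity)]
    nlinarith
  rw [curvature_eq_sum (hM i).1]
  linarith

theorem contDiffOn_curvature (g : Background)
    (hΦ : ∀ e ∈ (skeleton T).edgeSet, Φ e ∈ Icc 0 (Real.pi / 2)) {i : V}
    (hfin : (oppositeEdges T i).Finite) {r : ℝ → V → ℝ} {S : Set ℝ} {n : WithTop ℕ∞}
    (hpos : ∀ t ∈ S, ∀ j, 0 < r t j) (hr : ∀ j, ContDiffOn ℝ n (fun t => r t j) S) :
    ContDiffOn ℝ n (fun t => curvature g T Φ (r t) i) S := by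
  simp only [curvature_eq_sum hfin]
  refine contDiffOn_const.sub (ContDiffOn.sum fun e he => ?_)
  obtain ⟨j, k, φ, hφ, χ, hχ, ψ, hψ, h⟩ := exists_theta_eq hΦ (hfin.mem_toFinset.1 he)
  simp only [h]
  exact contDiffOn_faceAngle g hφ hχ hψ (fun t ht => hpos t ht i) (fun t ht => hpos t ht j)
    (fun t ht => hpos t ht k) (hr i) (hr j) (hr k)

end Curvature

/-! ### Smoothness, uniqueness and existence for the flow -/

section Solution

variable {V : Type*} {T : AbstractSimplicialComplex V} {Φ : Sym2 V → ℝ}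

theorem flowField_eq (g : Background) (T : AbstractSimplicialComplex V) (Φ : Sym2 V → ℝ)
    (r : V → ℝ) (i : V) : flowField g T Φ r i = speed g (r i) * -curvature g T Φ r i := by
  cases g <;> simp only [flowField, speed] <;> ring

/-- Bootstrap: if all radii are `C^n`, so is the right-hand side, hence all radii are `C^(n+1)`. The
induction runs over all vertices at once because the curvature involves the neighbours. -/
theorem IsSolution.contDiffOn {g : Background} {r₀ : V → ℝ} {r : ℝ → V → ℝ}
    (h : IsSolution g T Φ r₀ r)
    (hΦ : ∀ e ∈ (skeleton T).edgeSet, Φ e ∈ Icc 0 (Real.pi / 2))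
    (hfin : ∀ i, (oppositeEdges T i).Finite) (i : V) :
    ContDiffOn ℝ ∞ (fun t => r t i) (Ici 0) := by
  rw [contDiffOn_infty]
  intro n
  induction n generalizing i with
  | zero =>
    exact contDiffOn_zero.2 fun t ht => (h.flow t ht i).continuousWithinAt
  | succ n ih =>
    push_cast
    rw [contDiffOn_succ_iff_derivWithin (uniqueDiffOn_Ici 0)]
    refine ⟨fun t ht => (h.flow t ht i).differentiableWithinAt, by simp, ?_⟩
    have hc := contDiffOn_curvature g hΦ (hfin i) h.pos ih
    have hs : ContDiffOn ℝ n (fun t => speed g (r t i)) (Ici 0) := by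
      cases g with
      | euclidean => exact ih i
      | hyperbolic => exact (ih i).sinh
    refine (hs.mul hc.neg).congr fun t ht => ?_
    rw [(h.flow t ht i).derivWithin (uniqueDiffOn_Ici 0 t ht), flowField_eq]

theorem IsSolution.hasDerivWithinAt_coord {g : Background} {r₀ : V → ℝ} {r : ℝ → V → ℝ}
    (h : IsSolution g T Φ r₀ r) {t : ℝ} (ht : 0 ≤ t) (i : V) :
    HasDerivWithinAt (fun s => coord g (r s i)) (coordField g T Φ (fun j => coord g (r t j)) i)
      (Ici 0) t := by
  have hpos := h.pos t ht
  refine ((hasDerivAt_coord g (hpos i)).comp_hasDerivWithinAt t (h.flow t ht i)).congr_deriv ?_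
  have := (speed_pos g (hpos i)).ne'
  simp only [coordField, radius_coord g (hpos _)]
  rw [flowField_eq]
  field_simp

/-- Positivity alone puts the coordinates of both solutions in the region where the field is
uniform, so the uniqueness result for uniform fields applies. -/
theorem IsSolution.eq {g : Background} {r₀ : V → ℝ} {r r' : ℝ → V → ℝ}
    (h : IsSolution g T Φ r₀ r) (h' : IsSolution g T Φ r₀ r')
    (hΦ : ∀ e ∈ (skeleton T).edgeSet, Φ e ∈ Icc 0 (Real.pi / 2)) {M : ℕ}
    (hM : ∀ i, (oppositeEdges T i).Finite ∧ (oppositeEdges T i).ncard ≤ M) {t : ℝ}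
    (ht : 0 ≤ t) : r t = r' t := by
  have hu := (isUniformField_coordField g hΦ hM).eq_of_hasDerivWithinAt (T := t)
    (u := fun s j => coord g (r s j)) (v := fun s j => coord g (r' s j))
    (fun s hs j => coord_mem g (h.pos s hs.1 j)) (fun s hs j => coord_mem g (h'.pos s hs.1 j))
    (fun s hs j => (h.hasDerivWithinAt_coord hs.1 j).mono Icc_subset_Ici_self)
    (fun s hs j => (h'.hasDerivWithinAt_coord hs.1 j).mono Icc_subset_Ici_self)
    (by simp only [h.initial, h'.initial]) t ⟨ht, le_rfl⟩
  funext i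
  rw [← radius_coord g (h.pos t ht i), ← radius_coord g (h'.pos t ht i)]
  exact congrArg (radius g) (congrFun hu i)

theorem coord_hyperbolic_le {a b : ℝ} (ha : 0 < a) (hab : a ≤ b) :
    coord .hyperbolic a ≤ coord .hyperbolic b := by
  have hs := Real.sinh_pos_iff.2 ha
  exact neg_le_neg (Real.arsinh_le_arsinh.2
    (one_div_le_one_div_of_le hs (Real.sinh_le_sinh.2 hab)))

/-- In hyperbolic background geometry the field is truncated at a level at which it points
inwards; the solutions of the truncated flow never exceed that level. -/
theorem exists_coord_solution (g : Background)
    (hΦ : ∀ e ∈ (skeleton T).edgeSet, Φ e ∈ Icc 0 (Real.pi / 2)) {M : ℕ}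
    (hM : ∀ i, (oppositeEdges T i).Finite ∧ (oppositeEdges T i).ncard ≤ M)
    {r₀ : V → ℝ} (hr₀ : ∀ i, 0 < r₀ i) :
    ∃ u : ℝ → V → ℝ, (u 0 = fun i => coord g (r₀ i)) ∧ ∀ t, 0 ≤ t → ∀ i,
      u t i ∈ coordRange g ∧
        HasDerivWithinAt (fun s => u s i) (coordField g T Φ (u t) i) (Ici 0) t := by
  have hfield := isUniformField_coordField g hΦ hM
  have hC : 0 ≤ 2 * Real.pi + M * Real.pi := by have := Real.pi_pos; positivity
  have hL : (0 : ℝ) ≤ 64 * M := by positivity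
  cases g with
  | euclidean =>
    have huniv : {u : V → ℝ | ∀ i, u i ∈ coordRange .euclidean} = univ :=
      eq_univ_of_forall fun u i => mem_univ _
    rw [huniv] at hfield
    obtain ⟨u, hu0, hu⟩ :=
      hfield.exists_hasDerivWithinAt_Ici hC hL fun i => coord .euclidean (r₀ i)
    exact ⟨u, hu0, fun t ht i => ⟨mem_univ _, hu t ht i⟩⟩
  | hyperbolic =>
    obtain ⟨R, hR⟩ := exists_curvature_hyperbolic_pos hΦ hM
    -- `R` is uniform, but the level depends on the vertex so that it lies above the possibly
    -- unbounded initial radii.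
    let m : V → ℝ := fun i => coord .hyperbolic (max (r₀ i) R)
    have hmax : ∀ i, 0 < max (r₀ i) R := fun i => (hr₀ i).trans_le (le_max_left _ _)
    have hm : ∀ i, m i < 0 := fun i => coord_mem .hyperbolic (hmax i)
    have hmin : ∀ u : V → ℝ, (fun j => min (u j) (m j)) ∈
        {u : V → ℝ | ∀ i, u i ∈ coordRange .hyperbolic} :=
      fun u i => (min_le_right _ _).trans_lt (hm i)
    have htrunc : IsUniformField
        (fun u => coordField .hyperbolic T Φ fun j => min (u j) (m j)) univ _ _ :=
      ⟨fun u _ => hfield.bound _ (hmin u), fun u _ v _ δ huv =>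
        hfield.lipschitz _ (hmin u) _ (hmin v) δ fun j =>
          (abs_min_sub_min_le_max _ _ _ _).trans
            (by simpa using huv j)⟩
    obtain ⟨u, hu0, hu⟩ :=
      htrunc.exists_hasDerivWithinAt_Ici hC hL fun i => coord .hyperbolic (r₀ i)
    have hle : ∀ t, 0 ≤ t → ∀ i, u t i ≤ m i := by
      intro t ht i
      -- Only times with `u s i = m i` matter. There the truncated radius at `i` is `max (r₀ i) R ≥
      -- R`, so the curvature is positive and the derivative strictly negative, whatever the other
      -- coordinates are.
      refine image_le_of_deriv_right_lt_deriv_boundary (a := 0) (b := t)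
        (f := fun s => u s i) (B := fun _ => m i) (B' := fun _ => 0)
        (fun s hs => (hu s hs.1 i).continuousWithinAt.mono Icc_subset_Ici_self)
        (fun s hs => (hu s hs.1 i).mono (Ici_subset_Ici.2 hs.1)) ?_
        (fun s => hasDerivAt_const _ _) (fun s hs hsm => ?_) ⟨ht, le_rfl⟩
      · simp only [hu0]
        exact coord_hyperbolic_le (hr₀ i) (le_max_left _ _)
      · refine neg_lt_zero.2 (hR _ (fun j => radius_pos (hmin (u s) j)) i ?_)
        rw [hsm, min_self, radius_coord _ (hmax i)]
        exact le_max_right _ _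
    refine ⟨u, hu0, fun t ht i => ⟨(hle t ht i).trans_lt (hm i), ?_⟩⟩
    have heq : (fun j => min (u t j) (m j)) = u t := funext fun j => min_eq_left (hle t ht j)
    have := hu t ht i
    rwa [heq] at this

theorem exists_isSolution (g : Background)
    (hΦ : ∀ e ∈ (skeleton T).edgeSet, Φ e ∈ Icc 0 (Real.pi / 2)) {M : ℕ}
    (hM : ∀ i, (oppositeEdges T i).Finite ∧ (oppositeEdges T i).ncard ≤ M)
    {r₀ : V → ℝ} (hr₀ : ∀ i, 0 < r₀ i) : ∃ r, IsSolution g T Φ r₀ r := by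
  obtain ⟨u, hu0, hu⟩ := exists_coord_solution g hΦ hM hr₀
  refine ⟨fun t i => radius g (u t i), fun t ht i => radius_pos (hu t ht i).1, ?_,
    fun t ht i => ?_⟩
  · simp only [hu0, radius_coord g (hr₀ _)]
  · rw [flowField_eq]
    exact (hasDerivAt_radius (hu t ht i).1).comp_hasDerivWithinAt t (hu t ht i).2

end Solution

end CRF

end

theorem theorem1p2 {V : Type*} [Infinite V] (T : AbstractSimplicialComplex V)
    (hT : CRF.IsDiskTriangulation T)
    (hdeg : ∃ N : ℕ, ∀ i, CRF.degree T i ≤ N)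
    (Φ : Sym2 V → ℝ)
    (hΦ : ∀ e ∈ (CRF.skeleton T).edgeSet, Φ e ∈ Set.Icc 0 (Real.pi / 2))
    (g : CRF.Background) (r₀ : V → ℝ) (hr₀ : ∀ i, 0 < r₀ i) :
    ∃ r : ℝ → V → ℝ, CRF.IsSolution g T Φ r₀ r ∧
      (∀ i, ContDiffOn ℝ ∞ (fun t => r t i) (Set.Ici 0)) ∧
      ∀ r' : ℝ → V → ℝ, CRF.IsSolution g T Φ r₀ r' → ∀ t, 0 ≤ t → r' t = r t := by
  obtain ⟨M, hM⟩ := CRF.exists_ncard_oppositeEdges_le hdeg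
  obtain ⟨r, hr⟩ := CRF.exists_isSolution g hΦ hM hr₀
  exact ⟨r, hr, hr.contDiffOn hΦ fun i => (hM i).1, fun r' hr' t ht => hr'.eq hr hΦ hM ht⟩
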